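/- Notation. Let $k\in\mathbb Z$ and let $m\in\frac12\mathbb Z$, $m>0$. Write $q=e^{2\pi i\tau}$, $\zeta=e^{2\pi i z}$. A weak Jacobi form of weight $k$ and index $m$ is a holomorphic function $\varphi:\mathbb H\times\mathbb C\to\mathbb C$ with $$\varphi\Big(\tfrac{a\tau+b}{c\tau+d},\tfrac{z}{c\tau+d}\Big)=(c\tau+d)^k e^{2\pi i m\frac{cz^2}{c\tau+d}}\varphi(\tau,z),\qquad \varphi(\tau,z+x\tau+y)=(-1)^{2m(x+y)}e^{-2\pi i m(x^2\tau+2xz)}\varphi(\tau,z)$$ for all $\left(\begin{smallmatrix}a&b\\c&d\end{smallmatrix}\right)\in SL_2(\mathbb Z)$ and $x,y\in\mathbb Z$, and with a Fourier expansion $\varphi(\tau,z)=\sum_{n\ge0,\ l\in\frac12\mathbb Z}a(n,l)q^n\zeta^l$, where $l\in\frac12+\mathbb Z$ if $m\in\frac12+\mathbb Z$. Let $J^w_{k,m}$ be the space of these forms, and put $q^0[\varphi]=\sum_l a(0,l)\zeta^l$. Define $$H_k=12\,q\frac{d}{dq}-\frac3m\Big(\zeta\frac{d}{d\zeta}\Big)^2-\frac{2k-1}{2}E_2(\tau),\qquad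 H_k^{[3]}=H_{k+4}\circ H_{k+2}\circ H_k,$$ where $E_2=1-24\sum_{n\ge1}\sigma_1(n)q^n$, $E_4=1+240\sum_{n\ge1}\sigma_3(n)q^n$ and $E_6=1-504\sum_{n\ge1}\sigma_5(n)q^n$. Theorem. Let $\varphi\in J^w_{k,m}$ satisfy $(H_k^{[3]}+\lambda_1E_4H_k+\lambda_2E_6)(\varphi)=0$ for some $\lambda_1,\lambda_2\in\mathbb C$. Then: 1) If $\varphi\ne0$, then $k\ge-5$. 2) The set $\{|l| : a(0,l)\neq0\}$ has at most three elements. 3) Suppose that this set has exactly three elements, and let $a(0,l_1),a(0,l_2),a(0,l_3)$ be non-zero coefficients with pairwise distinct $|l_1|,|l_2|,|l_3|$. Then: a) $l_1^2+l_2^2+l_3^2=-\frac{2k+3}{2}m$; in particular, if $m$ is an integer, then $l_1,l_2,l_3\in\mathbb Z$ and $m$ is even. b) $k\in\{-2,-3,-4,-5\}$. c) Up to multiplication by a non-zero constant, the $q^0$-part is as follows, for some $a\in\mathbb C$ in the cases $k=-2$ and $k=-3$ (if $l_i=0$ then $\zeta^{l_i}+\zeta^{-l_i}=2$): - if $k=-2$: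 $q^0[\varphi]=(\zeta^{l_1}+\zeta^{-l_1})+a(\zeta^{l_2}+\zeta^{-l_2})-(a+1)(\zeta^{l_3}+\zeta^{-l_3})$, with $a\ne\frac{l_3^2-l_1^2}{l_2^2-l_3^2}$; - if $k=-4$: $q^0[\varphi]=(\zeta^{l_1}+\zeta^{-l_1})+\frac{l_3^2-l_1^2}{l_2^2-l_3^2}(\zeta^{l_2}+\zeta^{-l_2})+\frac{l_1^2-l_2^2}{l_2^2-l_3^2}(\zeta^{l_3}+\zeta^{-l_3})$; - if $k=-3$: $q^0[\varphi]=(\zeta^{l_1}-\zeta^{-l_1})+a(\zeta^{l_2}-\zeta^{-l_2})-\frac{l_1+al_2}{l_3}(\zeta^{l_3}-\zeta^{-l_3})$, with $a\ne\frac{l_1(l_3^2-l_1^2)}{l_2(l_2^2-l_3^2)}$; - if $k=-5$: $q^0[\varphi]=(\zeta^{l_1}-\zeta^{-l_1})+\frac{l_1(l_3^2-l_1^2)}{l_2(l_2^2-l_3^2)}(\zeta^{l_2}-\zeta^{-l_2})+\frac{l_1(l_1^2-l_2^2)}{l_3(l_2^2-l_3^2)}(\zeta^{l_3}-\zeta^{-l_3})$.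 -/

import Mathlib

/-!
# Weak Jacobi forms and the modular heat operator

The index `m ∈ ½ℕ` of a Jacobi form is recorded by the natural number `M = 2m`.
Functions on `ℍ × ℂ` are written in curried form `ℍ → ℂ → ℂ`.
-/

open scoped MatrixGroups UpperHalfPlane

noncomputable section

namespace JacobiMDE

/-- `φ(τ,z) = ∑_{n ≥ 0, l ∈ ½ℤ} a(n,l) exp(2πi(nτ + lz))`, the sum being absolutely convergent at
every point. The coefficients are indexed by `n ∈ ℕ` and `l ∈ ℚ` and are supported on `l ∈ ½ℤ`;
for a half-integral index (`M` odd) they are supported on `l ∈ ½ + ℤ`. -/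
structure HasFourierExpansion (M : ℕ) (φ : ℍ → ℂ → ℂ) (a : ℕ → ℚ → ℂ) : Prop where
  support : ∀ n l, a n l ≠ 0 → ∃ r : ℤ, l = (r : ℚ) / 2 ∧ (Odd M → Odd r)
  hasSum : ∀ (τ : ℍ) (z : ℂ),
    HasSum (fun p : ℕ × ℚ =>
      a p.1 p.2 * Complex.exp (2 * Real.pi * Complex.I * ((p.1 : ℂ) * τ + (p.2 : ℂ) * z))) (φ τ z)

/-- `φ` is a weak Jacobi form of weight `k` and index `m = M / 2`. -/
structure IsWeakJacobiForm (k : ℤ) (M : ℕ) (φ : ℍ → ℂ → ℂ) : Prop where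
  /-- Joint holomorphy on `ℍ × ℂ`. -/
  holo : DifferentiableOn ℂ (fun p : ℂ × ℂ => φ (UpperHalfPlane.ofComplex p.1) p.2)
    {p : ℂ × ℂ | 0 < p.1.im}
  modular : ∀ (γ : SL(2, ℤ)) (τ : ℍ) (z : ℂ),
    φ (γ • τ) (z / ((γ 1 0 : ℂ) * τ + (γ 1 1 : ℂ))) =
      ((γ 1 0 : ℂ) * τ + (γ 1 1 : ℂ)) ^ k *
        Complex.exp (2 * Real.pi * Complex.I * ((M : ℂ) / 2) *
          ((γ 1 0 : ℂ) * z ^ 2 / ((γ 1 0 : ℂ) * τ + (γ 1 1 : ℂ)))) * φ τ z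
  elliptic : ∀ (x y : ℤ) (τ : ℍ) (z : ℂ),
    φ τ (z + x * τ + y) =
      (-1 : ℂ) ^ ((M : ℤ) * (x + y)) *
        Complex.exp (-(2 * Real.pi * Complex.I * ((M : ℂ) / 2) * ((x : ℂ) ^ 2 * τ + 2 * x * z))) *
          φ τ z
  fourier : ∃ a : ℕ → ℚ → ℂ, HasFourierExpansion M φ a

/-- The heat operator `H^{(m)} = 12 q d/dq - (3/m) (ζ d/dζ)²` with `m = M / 2`, where
`q d/dq = (2πi)⁻¹ ∂/∂τ` and `ζ d/dζ = (2πi)⁻¹ ∂/∂z`. -/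
def heat (M : ℕ) (φ : ℍ → ℂ → ℂ) : ℍ → ℂ → ℂ := fun τ z =>
  12 * Derivative.normalizedDerivOfComplex (fun σ => φ σ z) τ -
    3 / ((M : ℂ) / 2) * (((2 * Real.pi * Complex.I) ^ 2)⁻¹ * iteratedDeriv 2 (φ τ) z)

/-- The modular heat operator `H_k = H^{(m)} - ((2k-1)/2) E₂` with `m = M / 2`. -/
def modularHeat (M : ℕ) (k : ℤ) (φ : ℍ → ℂ → ℂ) : ℍ → ℂ → ℂ := fun τ z =>
  heat M φ τ z - (2 * (k : ℂ) - 1) / 2 * EisensteinSeries.E2 τ * φ τ z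

/-- The iterate `H_k^{[n]} = H_{k+2(n-1)} ∘ ⋯ ∘ H_{k+2} ∘ H_k`. -/
def modularHeatIter (M : ℕ) (k : ℤ) : ℕ → (ℍ → ℂ → ℂ) → (ℍ → ℂ → ℂ)
  | 0, φ => φ
  | n + 1, φ => modularHeat M (k + 2 * n) (modularHeatIter M k n φ)

/-- `φ` solves the third-order equation `(H_k^{[3]} + λ₁ E₄ H_k + λ₂ E₆) φ = 0`. -/
def SolvesMDE3 (M : ℕ) (k : ℤ) (lam₁ lam₂ : ℂ) (φ : ℍ → ℂ → ℂ) : Prop :=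
  ∀ (τ : ℍ) (z : ℂ),
    modularHeatIter M k 3 φ τ z + lam₁ * ModularForm.E₄ τ * modularHeat M k φ τ z +
      lam₂ * ModularForm.E₆ τ * φ τ z = 0

/-- The monomial `ζ^l`, as a formal sum `∑_l c(l) ζ^l` given by its coefficient function
`c : ℚ → ℂ`. -/
def zetaPow (l : ℚ) : ℚ → ℂ := Pi.single l 1

end JacobiMDE

end

/-!
# Third-order modular differential equations for weak Jacobi forms

Two observations carry the proof.

*At the cusp.* As `Im τ → ∞`, a weak Jacobi form `φ(τ, z)` tends, locally uniformly in `z`, to its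
`q⁰`-part `φ₀(z) = ∑ a(0, l) ζ^l`, and by Cauchy's estimates its derivatives tend to those of `φ₀`
(`HasCuspLimit`). Since `E₂`, `E₄`, `E₆` have limits at the cusp, the equation becomes a linear
equation with constant coefficients for `φ₀` (`exists_cuspHeat_eq_zero`). Comparing Fourier
coefficients in `z`, each `l` with `a(0, l) ≠ 0` gives a root `-3l²/m` of a fixed monic cubic
(`IsWeakJacobiForm.indicial_equation`). Hence at most three values of `|l|` occur, and if there are
three, Vieta's formula gives `∑ lᵢ²` (`IsWeakJacobiForm.sum_sq_exponents`); its positivity forces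
`k ≤ -2`.

*At `z = 0`.* Each of the three heat operators in `H_k^{[3]}` involves `∂²/∂z²` with a nonzero
constant factor, so comparing Taylor coefficients in `z` shows that a solution vanishing to order
`6` along `z = 0` is zero (`eq_zero_of_vanishesToOrder_six`). On the other hand, if `φ` vanishes to
order `n` along `z = 0`, its `n`-th Taylor coefficient is a modular form of weight `k + n` for
`SL₂(ℤ)` (`IsWeakJacobiForm.exists_modularForm`). It is therefore zero if `k + n` is negative, odd
or equal to `2`, and constant if `k + n = 0`. So a nonzero solution has `k ≥ -5`. For
`-5 ≤ k ≤ -2` the Taylor coefficients of negative weight vanish, and the one of weight zero does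
not, as otherwise those of weights `1`, `2` and `3` would vanish too. The values of the Taylor
coefficients at the cusp are the moments `∑ a(0, l) (2πil)ⁿ`, and the resulting linear conditions
on the `a(0, lᵢ)` give the shape of the `q⁰`-part.

Differentiation of a holomorphic function of two variables needs that partial derivatives are again
holomorphic and commute (`differentiableOn_fderiv_apply`, `fderiv_fderiv_apply_comm`), which is
deduced from the Schwarz lemma on balls of a normed space.
-/

noncomputable section

namespace JacobiMDE

open Filter Topology Metric Set UpperHalfPlane
open scoped Manifold

/-! ### Holomorphic functions on open subsets of normed spaces -/

section SeveralVariables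

variable {E : Type*} [NormedAddCommGroup E] [NormedSpace ℂ E]

/-- A Cauchy estimate: a bound on a ball bounds the derivative at its centre. -/
theorem norm_fderiv_le_of_norm_le {f : E → ℂ} {p : E} {r C : ℝ} (hr : 0 < r)
    (hf : DifferentiableOn ℂ f (ball p r)) (hC : ∀ y ∈ ball p r, ‖f y‖ ≤ C) :
    ‖fderiv ℂ f p‖ ≤ 2 * C / r := by
  refine Complex.norm_fderiv_le_div_of_mapsTo_ball hf (fun y hy => ?_) hr
  rw [mem_closedBall, dist_eq_norm]
  linarith [norm_sub_le (f y) (f p), hC y hy, hC p (mem_ball_self hr)]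

/-- Weierstrass' theorem: a uniform limit of holomorphic functions on a ball of a complex normed
space is differentiable at the centre. -/
theorem differentiableAt_of_tendstoUniformlyOn_ball {F : ℕ → E → ℂ} {g : E → ℂ} {p : E} {r : ℝ}
    (hr : 0 < r) (hF : ∀ n, DifferentiableOn ℂ (F n) (ball p r))
    (hg : TendstoUniformlyOn F g atTop (ball p r)) : DifferentiableAt ℂ g p := by
  have hsub : ∀ x ∈ ball p (r / 2), ball x (r / 2) ⊆ ball p r := fun x hx =>
    ball_subset_ball' (by rw [mem_ball] at hx; linarith)
  have hcau : UniformCauchySeqOn (fun n => fderiv ℂ (F n)) atTop (ball p (r / 2)) := by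
    rw [Metric.uniformCauchySeqOn_iff]
    intro ε hε
    obtain ⟨N, hN⟩ := Metric.uniformCauchySeqOn_iff.mp hg.uniformCauchySeqOn (ε * r / 8)
      (by positivity)
    refine ⟨N, fun m hm n hn x hx => ?_⟩
    have hd : ∀ n, DifferentiableOn ℂ (F n) (ball x (r / 2)) := fun n => (hF n).mono (hsub x hx)
    have hda : ∀ n, DifferentiableAt ℂ (F n) x := fun n =>
      (hd n).differentiableAt (ball_mem_nhds x (by positivity))
    have h := norm_fderiv_le_of_norm_le (f := F m - F n) (p := x) (C := ε * r / 8)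
      (half_pos hr) ((hd m).sub (hd n)) (fun y hy => by
        have := hN m hm n hn y (hsub x hx hy)
        rw [dist_eq_norm] at this
        exact this.le)
    rw [fderiv_sub (hda m) (hda n)] at h
    rw [dist_eq_norm]
    refine h.trans_lt ?_
    have : 2 * (ε * r / 8) / (r / 2) = ε / 2 := by field_simp; ring
    linarith
  have hlim : ∀ x ∈ ball p (r / 2), ∃ L : E →L[ℂ] ℂ,
      Tendsto (fun n => fderiv ℂ (F n) x) atTop (𝓝 L) := fun x hx =>
    cauchySeq_tendsto_of_complete (hcau.cauchySeq hx)
  choose! G hG using hlim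
  have hunif := hcau.tendstoUniformlyOn_of_tendsto hG
  have hball : ball p (r / 2) ⊆ ball p r := ball_subset_ball (by linarith)
  exact (hasFDerivAt_of_tendstoUniformlyOn isOpen_ball hunif
    (fun n x hx => ((hF n).differentiableAt (isOpen_ball.mem_nhds (hball hx))).hasFDerivAt)
    (fun x hx => hg.tendsto_at (hball hx)) (mem_ball_self (half_pos hr))).differentiableAt

/-- The Taylor remainder of first order of a bounded holomorphic function is quadratic. -/
theorem norm_sub_sub_fderiv_le {f : E → ℂ} {p y : E} {r C : ℝ} (hr : 0 < r)
    (hf : DifferentiableOn ℂ f (ball p r)) (hC : ∀ y ∈ ball p r, ‖f y‖ ≤ C) (hy : y ∈ ball p r) :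
    ‖f y - f p - fderiv ℂ f p (y - p)‖ ≤ 4 * C * (‖y - p‖ / r) ^ 2 := by
  have hfp := hf.differentiableAt (ball_mem_nhds p hr)
  have h := Complex.dist_le_mul_div_pow_of_mapsTo_ball_of_isLittleO (n := 1)
    (f := fun x => f x - fderiv ℂ f p (x - p)) (c := p) (z := y) (R₁ := r) (R₂ := 4 * C)
    (hf.sub (by fun_prop)) (fun x hx => ?_) ?_ hy
  · simpa [dist_eq_norm, sub_right_comm] using h
  · have h1 := norm_fderiv_le_of_norm_le hr hf hC
    have h2 : ‖fderiv ℂ f p (x - p)‖ ≤ 2 * C := by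
      refine ((fderiv ℂ f p).le_opNorm _).trans ?_
      have hx' : ‖x - p‖ ≤ r := by rw [mem_ball, dist_eq_norm] at hx; exact hx.le
      calc _ ≤ 2 * C / r * r := mul_le_mul h1 hx' (norm_nonneg _) ((norm_nonneg _).trans h1)
        _ = 2 * C := by field_simp
    have h3 := norm_sub_le (f x - f p) (fderiv ℂ f p (x - p))
    have h4 := norm_sub_le (f x) (f p)
    rw [mem_closedBall, dist_eq_norm]
    simp only [sub_self, map_zero, sub_zero]
    rw [sub_right_comm]
    linarith [hC x hx, hC p (mem_ball_self hr)]
  · have := hfp.hasFDerivAt.isLittleO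
    simpa [sub_right_comm] using this

/-- Directional derivatives of holomorphic functions are holomorphic, being locally uniform limits
of difference quotients. -/
theorem differentiableOn_fderiv_apply {f : E → ℂ} {U : Set E} (hU : IsOpen U)
    (hf : DifferentiableOn ℂ f U) (v : E) : DifferentiableOn ℂ (fun p => fderiv ℂ f p v) U := by
  intro x₀ hx₀
  refine DifferentiableAt.differentiableWithinAt ?_
  -- a ball of radius `2 r` around `x₀` on which `f` is holomorphic and bounded
  obtain ⟨r, C, hr, hrU, hC⟩ : ∃ r C : ℝ, 0 < r ∧ ball x₀ (2 * r) ⊆ U ∧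
      ∀ y ∈ ball x₀ (2 * r), ‖f y‖ ≤ C := by
    have hc : ∀ᶠ y in 𝓝 x₀, y ∈ U ∧ ‖f y‖ ≤ ‖f x₀‖ + 1 := by
      filter_upwards [hU.mem_nhds hx₀,
        (hf.continuousOn.continuousAt (hU.mem_nhds hx₀)).norm.eventually_lt_const
          (lt_add_one ‖f x₀‖)] with y h1 h2 using ⟨h1, h2.le⟩
    obtain ⟨ρ, hρ, h⟩ := Metric.eventually_nhds_iff_ball.mp hc
    refine ⟨ρ / 2, ‖f x₀‖ + 1, half_pos hρ, fun y hy => (h y ?_).1, fun y hy => (h y ?_).2⟩ <;>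
    simpa [mul_div_cancel₀] using hy
  have hsub : ∀ p ∈ ball x₀ r, ball p r ⊆ ball x₀ (2 * r) := fun p hp =>
    ball_subset_ball' (by rw [mem_ball] at hp; linarith)
  -- step sizes `t n` tending to zero, all so small that `p + t n • v` stays in `ball p r`
  set δ : ℝ := r / (‖v‖ + 1) with hδ
  have hv : 0 < ‖v‖ + 1 := by positivity
  have hδ0 : 0 < δ := by positivity
  let t : ℕ → ℝ := fun n => δ / (n + 1)
  have ht0 : ∀ n, 0 < t n := fun n => by positivity
  have htδ : ∀ n, t n ≤ δ := fun n => div_le_self hδ0.le (by simp)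
  have htv : ∀ n, ‖(t n : ℂ) • v‖ < r := fun n => by
    rw [norm_smul, Complex.norm_real, Real.norm_of_nonneg (ht0 n).le]
    calc t n * ‖v‖ ≤ δ * ‖v‖ := by gcongr; exact htδ n
      _ < δ * (‖v‖ + 1) := by gcongr; linarith
      _ = r := by rw [hδ]; field_simp
  have hmem : ∀ n, ∀ p, p + (t n : ℂ) • v ∈ ball p r := fun n p => by
    rw [mem_ball, dist_eq_norm, add_sub_cancel_left]; exact htv n
  refine differentiableAt_of_tendstoUniformlyOn_ball hr
    (F := fun n p => (t n : ℂ)⁻¹ * (f (p + (t n : ℂ) • v) - f p)) (fun n => ?_) ?_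
  · refine DifferentiableOn.const_mul (DifferentiableOn.sub ?_ ?_) _
    · exact hf.comp (by fun_prop) fun p hp => hrU (hsub p hp (hmem n p))
    · exact hf.mono fun p hp => hrU (hsub p hp (mem_ball_self hr))
  · rw [Metric.tendstoUniformlyOn_iff]
    intro ε hε
    have hlim : Tendsto (fun n => 4 * C * (‖v‖ / r) ^ 2 * t n) atTop (𝓝 0) := by
      have : Tendsto t atTop (𝓝 0) := by
        simpa [t, div_eq_mul_inv] using (tendsto_one_div_add_atTop_nhds_zero_nat (𝕜 := ℝ)).const_mul δ
      simpa using this.const_mul (4 * C * (‖v‖ / r) ^ 2)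
    filter_upwards [hlim.eventually_lt_const hε] with n hn p hp
    have h := norm_sub_sub_fderiv_le hr (hf.mono ((hsub p hp).trans hrU))
      (fun y hy => hC y (hsub p hp hy)) (hmem n p)
    refine lt_of_le_of_lt ?_ hn
    have htn : (t n : ℂ) ≠ 0 := by exact_mod_cast (ht0 n).ne'
    have heq : fderiv ℂ f p v - (t n : ℂ)⁻¹ * (f (p + (t n : ℂ) • v) - f p) =
        -((t n : ℂ)⁻¹ * (f (p + (t n : ℂ) • v) - f p - fderiv ℂ f p (p + (t n : ℂ) • v - p))) := by
      rw [add_sub_cancel_left, map_smul, smul_eq_mul]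
      field_simp
      ring
    rw [dist_eq_norm, heq, norm_neg, norm_mul, norm_inv, Complex.norm_real,
      Real.norm_of_nonneg (ht0 n).le]
    rw [add_sub_cancel_left, norm_smul, Complex.norm_real, Real.norm_of_nonneg (ht0 n).le] at h
    calc _ ≤ (t n)⁻¹ * (4 * C * (t n * ‖v‖ / r) ^ 2) := by
          have := (ht0 n).le; gcongr; simpa using h
      _ = _ := by have := (ht0 n).ne'; field_simp

end SeveralVariables

/-- The mixed partial derivatives of a holomorphic function of two variables agree. -/
theorem fderiv_fderiv_apply_comm {f : ℂ × ℂ → ℂ} {U : Set (ℂ × ℂ)} (hU : IsOpen U)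
    (hf : DifferentiableOn ℂ f U) {p : ℂ × ℂ} (hp : p ∈ U) (v w : ℂ × ℂ) :
    fderiv ℂ (fun x => fderiv ℂ f x v) p w = fderiv ℂ (fun x => fderiv ℂ f x w) p v := by
  have hd : ∀ u, DifferentiableAt ℂ (fun x => fderiv ℂ f x u) p := fun u =>
    (differentiableOn_fderiv_apply hU hf u).differentiableAt (hU.mem_nhds hp)
  have hf' : DifferentiableAt ℂ (fderiv ℂ f) p := by
    have : fderiv ℂ f = fun x =>
        fderiv ℂ f x (1, 0) • ContinuousLinearMap.fst ℂ ℂ ℂ +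
          fderiv ℂ f x (0, 1) • ContinuousLinearMap.snd ℂ ℂ ℂ := by
      funext x
      ext <;> simp
    rw [this]
    exact ((hd _).smul_const _).add ((hd _).smul_const _)
  have hsymm := second_derivative_symmetric_of_eventually (𝕜 := ℂ) (f := f) (f' := fderiv ℂ f)
    (by filter_upwards [hU.mem_nhds hp] with y hy
        exact (hf.differentiableAt (hU.mem_nhds hy)).hasFDerivAt) hf'.hasFDerivAt v w
  have key : ∀ u u', fderiv ℂ (fun x => fderiv ℂ f x u) p u' =
      fderiv ℂ (fderiv ℂ f) p u' u := fun u u' => by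
    rw [fderiv_clm_apply hf' (by fun_prop)]
    simp
  rw [key, key, hsymm]

/-! ### Holomorphic functions on `ℍ × ℂ` and their partial derivatives -/

/-- Joint holomorphy on `ℍ × ℂ` of a function in curried form. -/
def IsHolo (ψ : ℍ → ℂ → ℂ) : Prop :=
  DifferentiableOn ℂ (fun p : ℂ × ℂ => ψ (ofComplex p.1) p.2) {p : ℂ × ℂ | 0 < p.1.im}

/-- The derivative `q d/dq = (2πi)⁻¹ ∂/∂τ` in the first variable. -/
def dTau (ψ : ℍ → ℂ → ℂ) : ℍ → ℂ → ℂ := fun τ z =>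
  Derivative.normalizedDerivOfComplex (fun σ => ψ σ z) τ

/-- The derivative `∂/∂z` in the second variable. -/
def dZ (ψ : ℍ → ℂ → ℂ) : ℍ → ℂ → ℂ := fun τ => deriv (ψ τ)

lemma isOpen_im_fst_pos : IsOpen {p : ℂ × ℂ | 0 < p.1.im} :=
  isOpen_lt continuous_const (Complex.continuous_im.comp continuous_fst)

namespace IsHolo

variable {ψ χ : ℍ → ℂ → ℂ}

lemma differentiableAt (h : IsHolo ψ) {p : ℂ × ℂ} (hp : 0 < p.1.im) :
    DifferentiableAt ℂ (fun p : ℂ × ℂ => ψ (ofComplex p.1) p.2) p :=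
  DifferentiableOn.differentiableAt h (isOpen_im_fst_pos.mem_nhds hp)

lemma mdifferentiable (h : IsHolo ψ) (z : ℂ) : MDiff (fun τ => ψ τ z) := by
  rw [UpperHalfPlane.mdifferentiable_iff]
  exact DifferentiableOn.comp h (f := fun t : ℂ => (t, z)) (by fun_prop) fun t ht => ht

lemma differentiable (h : IsHolo ψ) (τ : ℍ) : Differentiable ℂ (ψ τ) := fun z => by
  have := DifferentiableAt.comp z (h.differentiableAt (p := ((τ : ℂ), z)) τ.im_pos)
    (f := fun w : ℂ => ((τ : ℂ), w)) (by fun_prop)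
  simpa [Function.comp_def] using this

lemma of_mdifferentiable {f : ℍ → ℂ} (hf : MDiff f) : IsHolo (fun τ _ => f τ) := by
  rw [UpperHalfPlane.mdifferentiable_iff] at hf
  exact DifferentiableOn.comp hf (f := fun p : ℂ × ℂ => p.1) (by fun_prop) fun p hp => hp

lemma add (h : IsHolo ψ) (h' : IsHolo χ) : IsHolo (fun τ z => ψ τ z + χ τ z) :=
  DifferentiableOn.add h h'

lemma sub (h : IsHolo ψ) (h' : IsHolo χ) : IsHolo (fun τ z => ψ τ z - χ τ z) :=
  DifferentiableOn.sub h h'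

lemma mul (h : IsHolo ψ) (h' : IsHolo χ) : IsHolo (fun τ z => ψ τ z * χ τ z) :=
  DifferentiableOn.mul h h'

lemma const_mul (h : IsHolo ψ) (c : ℂ) : IsHolo (fun τ z => c * ψ τ z) :=
  DifferentiableOn.const_mul h c

lemma dZ_eq_fderiv (h : IsHolo ψ) {p : ℂ × ℂ} (hp : 0 < p.1.im) :
    dZ ψ (ofComplex p.1) p.2 =
      fderiv ℂ (fun p : ℂ × ℂ => ψ (ofComplex p.1) p.2) p (0, 1) := by
  have h1 : HasDerivAt (fun w : ℂ => (p.1, w)) ((0 : ℂ), (1 : ℂ)) p.2 :=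
    (hasDerivAt_const _ _).prodMk (hasDerivAt_id _)
  exact ((h.differentiableAt hp).hasFDerivAt.comp_hasDerivAt p.2 h1).deriv

lemma dTau_eq_fderiv (h : IsHolo ψ) {p : ℂ × ℂ} (hp : 0 < p.1.im) :
    dTau ψ (ofComplex p.1) p.2 = (2 * Real.pi * Complex.I)⁻¹ *
      fderiv ℂ (fun p : ℂ × ℂ => ψ (ofComplex p.1) p.2) p (1, 0) := by
  have h1 : HasDerivAt (fun t : ℂ => (t, p.2)) ((1 : ℂ), (0 : ℂ)) p.1 :=
    (hasDerivAt_id _).prodMk (hasDerivAt_const _ _)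
  have h2 := ((h.differentiableAt hp).hasFDerivAt.comp_hasDerivAt p.1 h1).deriv
  rw [← h2, dTau, Derivative.normalizedDerivOfComplex, ofComplex_apply_of_im_pos hp]
  rfl

lemma dZ (h : IsHolo ψ) : IsHolo (dZ ψ) :=
  (differentiableOn_fderiv_apply isOpen_im_fst_pos h (0, 1)).congr fun _ hp => h.dZ_eq_fderiv hp

lemma dTau (h : IsHolo ψ) : IsHolo (dTau ψ) :=
  ((differentiableOn_fderiv_apply isOpen_im_fst_pos h (1, 0)).const_mul _).congr
    fun _ hp => h.dTau_eq_fderiv hp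

lemma dZ_dTau (h : IsHolo ψ) : JacobiMDE.dZ (JacobiMDE.dTau ψ) =
    JacobiMDE.dTau (JacobiMDE.dZ ψ) := by
  funext τ z
  have hp : 0 < ((τ : ℂ), z).1.im := τ.im_pos
  have hmem := isOpen_im_fst_pos.mem_nhds hp
  have h1 := h.dTau.dZ_eq_fderiv hp
  have h2 := h.dZ.dTau_eq_fderiv hp
  have e1 : (fun p : ℂ × ℂ => JacobiMDE.dTau ψ (ofComplex p.1) p.2) =ᶠ[𝓝 ((τ : ℂ), z)]
      fun p => (2 * Real.pi * Complex.I)⁻¹ *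
        fderiv ℂ (fun p : ℂ × ℂ => ψ (ofComplex p.1) p.2) p (1, 0) := by
    filter_upwards [hmem] with p hp using h.dTau_eq_fderiv hp
  have e2 : (fun p : ℂ × ℂ => JacobiMDE.dZ ψ (ofComplex p.1) p.2) =ᶠ[𝓝 ((τ : ℂ), z)]
      fun p => fderiv ℂ (fun p : ℂ × ℂ => ψ (ofComplex p.1) p.2) p (0, 1) := by
    filter_upwards [hmem] with p hp using h.dZ_eq_fderiv hp
  rw [e1.fderiv_eq, fderiv_const_mul ((differentiableOn_fderiv_apply isOpen_im_fst_pos h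
    (1, 0)).differentiableAt hmem)] at h1
  rw [e2.fderiv_eq, fderiv_fderiv_apply_comm isOpen_im_fst_pos h hp] at h2
  simpa [ofComplex_apply] using h1.trans h2.symm

end IsHolo

/-! ### Behaviour at the cusp -/

/-- `ψ` is holomorphic on `ℍ × ℂ`, and `ψ(τ, ·) → ψ₀` locally uniformly on `ℂ` as `Im τ → ∞`. For a
weak Jacobi form, `ψ₀` is the `q⁰`-part. -/
structure HasCuspLimit (ψ : ℍ → ℂ → ℂ) (ψ₀ : ℂ → ℂ) : Prop where
  holo : IsHolo ψ
  lim : TendstoLocallyUniformly ψ ψ₀ atImInfty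

namespace HasCuspLimit

variable {ψ χ : ℍ → ℂ → ℂ} {ψ₀ χ₀ : ℂ → ℂ}

lemma tendsto (h : HasCuspLimit ψ ψ₀) (z : ℂ) :
    Tendsto (fun τ => ψ τ z) atImInfty (𝓝 (ψ₀ z)) :=
  (tendstoLocallyUniformlyOn_univ.mpr h.lim).tendsto_at (mem_univ z)

lemma differentiable_limit (h : HasCuspLimit ψ ψ₀) : Differentiable ℂ ψ₀ := by
  rw [← differentiableOn_univ]
  exact (tendstoLocallyUniformlyOn_univ.mpr h.lim).differentiableOn
    (Eventually.of_forall fun τ => (h.holo.differentiable τ).differentiableOn) isOpen_univ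

lemma add (h : HasCuspLimit ψ ψ₀) (h' : HasCuspLimit χ χ₀) :
    HasCuspLimit (fun τ z => ψ τ z + χ τ z) (fun z => ψ₀ z + χ₀ z) :=
  ⟨h.holo.add h'.holo, h.lim.fun_add h'.lim⟩

lemma sub (h : HasCuspLimit ψ ψ₀) (h' : HasCuspLimit χ χ₀) :
    HasCuspLimit (fun τ z => ψ τ z - χ τ z) (fun z => ψ₀ z - χ₀ z) :=
  ⟨h.holo.sub h'.holo, h.lim.fun_sub h'.lim⟩

lemma mul (h : HasCuspLimit ψ ψ₀) (h' : HasCuspLimit χ χ₀) :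
    HasCuspLimit (fun τ z => ψ τ z * χ τ z) (fun z => ψ₀ z * χ₀ z) :=
  ⟨h.holo.mul h'.holo, TendstoLocallyUniformly.fun_mul₀ h.lim h'.lim
    h.differentiable_limit.continuous h'.differentiable_limit.continuous⟩

lemma of_tendsto {f : ℍ → ℂ} {c : ℂ} (hf : MDiff f) (hc : Tendsto f atImInfty (𝓝 c)) :
    HasCuspLimit (fun τ _ => f τ) (fun _ => c) := by
  refine ⟨.of_mdifferentiable hf, ?_⟩
  rw [Metric.tendstoLocallyUniformly_iff]
  intro ε hε x
  refine ⟨univ, univ_mem, ?_⟩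
  filter_upwards [Metric.tendsto_nhds.mp hc ε hε] with τ hτ y _
  rwa [dist_comm]

lemma const (c : ℂ) : HasCuspLimit (fun _ _ => c) (fun _ => c) :=
  of_tendsto (fun _ => mdifferentiableAt_const) tendsto_const_nhds

lemma dZ (h : HasCuspLimit ψ ψ₀) : HasCuspLimit (dZ ψ) (deriv ψ₀) := by
  refine ⟨h.holo.dZ, ?_⟩
  rw [← tendstoLocallyUniformlyOn_univ]
  exact (tendstoLocallyUniformlyOn_univ.mpr h.lim).deriv
    (Eventually.of_forall fun τ => (h.holo.differentiable τ).differentiableOn) isOpen_univ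

/-- The derivative in `τ` tends to `0` at the cusp, by Cauchy's estimate on discs of radius `1`
around `τ`. -/
lemma dTau (h : HasCuspLimit ψ ψ₀) : HasCuspLimit (dTau ψ) (fun _ => 0) := by
  refine ⟨h.holo.dTau, ?_⟩
  have hlim := h.lim
  rw [Metric.tendstoLocallyUniformly_iff] at hlim ⊢
  intro ε hε x
  have hpi : 0 < ‖(2 * Real.pi * Complex.I)⁻¹‖ := by
    simp [Real.pi_ne_zero]
  set η := ε / (2 * ‖(2 * Real.pi * Complex.I)⁻¹‖) with hη
  obtain ⟨t, ht, hev⟩ := hlim η (by positivity) x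
  refine ⟨t, ht, ?_⟩
  obtain ⟨A, hA⟩ := (atImInfty_mem _).mp hev
  refine (atImInfty_mem _).mpr ⟨max A 0 + 2, fun τ hτ w hw => ?_⟩
  have him : ∀ s ∈ closedBall (τ : ℂ) 1, max A 0 + 1 ≤ s.im := fun s hs => by
    have h1 : ‖s - τ‖ ≤ 1 := by simpa [dist_eq_norm] using hs
    have h2 := (abs_le.mp ((Complex.abs_im_le_norm (s - τ)).trans h1)).1
    rw [Complex.sub_im, coe_im] at h2
    linarith
  have hpos : ∀ s ∈ closedBall (τ : ℂ) 1, 0 < s.im := fun s hs => by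
    linarith [him s hs, le_max_right A 0]
  have hbound : ‖deriv (fun s : ℂ => ψ (ofComplex s) w - ψ₀ w) τ‖ ≤ η / 1 := by
    refine Complex.norm_deriv_le_of_forall_mem_sphere_norm_le one_pos ?_ fun s hs => ?_
    · refine DifferentiableOn.diffContOnCl ?_
      rw [closure_ball _ one_ne_zero]
      exact ((UpperHalfPlane.mdifferentiable_iff.mp (h.holo.mdifferentiable w)).mono
        fun s hs => hpos s hs).sub_const _
    · have hs' := sphere_subset_closedBall hs
      have := hA (ofComplex s) (by
        rw [ofComplex_apply_of_im_pos (hpos s hs')]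
        change A ≤ s.im
        linarith [him s hs', le_max_left A 0]) w hw
      rw [dist_comm, dist_eq_norm] at this
      exact this.le
  rw [deriv_sub_const, div_one] at hbound
  rw [dist_comm, dist_zero_right]
  change ‖(2 * Real.pi * Complex.I)⁻¹ * deriv (fun s : ℂ => ψ (ofComplex s) w) τ‖ < ε
  rw [norm_mul]
  calc _ ≤ ‖(2 * Real.pi * Complex.I)⁻¹‖ * η := by gcongr
    _ = ε / 2 := by rw [hη]; field_simp
    _ < ε := half_lt_self hε

end HasCuspLimit

/-! ### Fourier expansions at the cusp -/

lemma norm_exp_two_pi_I_mul (N : ℕ) (l : ℚ) (t z : ℂ) :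
    ‖Complex.exp (2 * Real.pi * Complex.I * ((N : ℂ) * t + (l : ℂ) * z))‖ =
      Real.exp (-(2 * Real.pi * (N * t.im + l * z.im))) := by
  rw [Complex.norm_exp]
  congr 1
  have h : (N : ℂ) * t + (l : ℂ) * z = ((N : ℝ) : ℂ) * t + ((l : ℝ) : ℂ) * z := by push_cast; rfl
  have h2 : (2 * Real.pi * Complex.I : ℂ) = ((2 * Real.pi : ℝ) : ℂ) * Complex.I := by push_cast; rfl
  rw [h, h2, mul_assoc, Complex.re_ofReal_mul, Complex.I_mul_re, Complex.add_im,
    Complex.im_ofReal_mul, Complex.im_ofReal_mul]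
  ring

/-- An absolutely convergent series `∑ cᵢ q^(Nᵢ) ζ^(lᵢ)` with all `Nᵢ ≥ 0` converges, locally
uniformly in `z`, to its part with `Nᵢ = 0` as `Im τ → ∞`. -/
theorem tendstoLocallyUniformly_of_hasSum {ι : Type*} {c : ι → ℂ} {N : ι → ℕ} {l : ι → ℚ}
    {ψ : ℍ → ℂ → ℂ} {ψ₀ : ℂ → ℂ}
    (h : ∀ (τ : ℍ) (z : ℂ), HasSum (fun i => c i *
      Complex.exp (2 * Real.pi * Complex.I * ((N i : ℂ) * τ + (l i : ℂ) * z))) (ψ τ z))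
    (h₀ : ∀ z : ℂ, HasSum (fun i => if N i = 0 then c i *
      Complex.exp (2 * Real.pi * Complex.I * ((l i : ℂ) * z)) else 0) (ψ₀ z)) :
    TendstoLocallyUniformly ψ ψ₀ atImInfty := by
  rw [Metric.tendstoLocallyUniformly_iff]
  intro ε hε x
  set R : ℝ := ‖x‖ + 1
  -- the series dominating the tail uniformly for `Im τ ≥ 1` and `|Im z| ≤ R`
  have hsum := fun s : ℝ => (h UpperHalfPlane.I (s * Complex.I)).summable.norm
  simp only [norm_mul, norm_exp_two_pi_I_mul] at hsum
  have hK := (hsum R).add (hsum (-R))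
  set b : ι → ℝ := fun i =>
    ‖c i‖ * Real.exp (-(2 * Real.pi * (N i * (UpperHalfPlane.I : ℂ).im +
        l i * ((R : ℝ) * Complex.I : ℂ).im))) +
      ‖c i‖ * Real.exp (-(2 * Real.pi * (N i * (UpperHalfPlane.I : ℂ).im +
        l i * (((-R : ℝ) : ℂ) * Complex.I : ℂ).im))) with hb
  set K : ℝ := ∑' i, b i with hKdef
  refine ⟨ball x 1, ball_mem_nhds x one_pos, ?_⟩
  have hlim : Tendsto (fun τ : ℍ => Real.exp (-(2 * Real.pi * (τ.im - 1))) * K) atImInfty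
      (𝓝 0) := by
    have h1 : Tendsto (fun τ : ℍ => τ.im) atImInfty atTop := tendsto_comap
    have h2 : Tendsto (fun τ : ℍ => 2 * Real.pi * (τ.im - 1)) atImInfty atTop :=
      (tendsto_atTop_add_const_right _ (-1) h1).const_mul_atTop (by positivity)
    simpa using ((Real.tendsto_exp_neg_atTop_nhds_zero.comp h2).mul_const K)
  filter_upwards [hlim.eventually_lt_const hε, (atImInfty_mem _).mpr ⟨1, fun τ hτ => hτ⟩]
    with τ hτ hτ1 z hz
  change 1 ≤ τ.im at hτ1
  refine lt_of_le_of_lt ?_ hτ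
  rw [dist_comm, dist_eq_norm, hKdef, ← tsum_mul_left, ← ((h τ z).sub (h₀ z)).tsum_eq]
  refine tsum_of_norm_bounded (hK.mul_left _).hasSum fun i => ?_
  have hzR : |z.im| ≤ R := by
    refine (Complex.abs_im_le_norm z).trans ?_
    have := norm_sub_norm_le z x
    rw [mem_ball, dist_eq_norm] at hz
    linarith
  by_cases hN : N i = 0
  · simp only [hN, if_true, Nat.cast_zero, zero_mul, zero_add, sub_self, norm_zero, hb]
    positivity
  have hN1 : (1 : ℝ) ≤ N i := by exact_mod_cast Nat.one_le_iff_ne_zero.mpr hN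
  rw [if_neg hN, sub_zero, norm_mul, norm_exp_two_pi_I_mul]
  simp only [hb, Complex.mul_im, Complex.ofReal_re, Complex.ofReal_im, Complex.I_re, Complex.I_im,
    mul_one, zero_mul, add_zero, coe_I, ← mul_add]
  rw [mul_left_comm]
  refine mul_le_mul_of_nonneg_left ?_ (norm_nonneg _)
  -- the sign of `l i` decides which of `± R` dominates
  have hexp : -(2 * Real.pi * (N i * τ.im + l i * z.im)) ≤
      -(2 * Real.pi * (τ.im - 1)) + -(2 * Real.pi * (N i - |(l i : ℝ)| * R)) := by
    have h1 : -(l i * z.im) ≤ |(l i : ℝ)| * R := by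
      refine (neg_le_abs _).trans ?_
      rw [abs_mul]
      gcongr
    have h2 : (0 : ℝ) ≤ (N i - 1) * (τ.im - 1) := mul_nonneg (by linarith) (by linarith)
    have h3 := Real.pi_pos
    nlinarith
  refine (Real.exp_le_exp.mpr hexp).trans ?_
  rw [Real.exp_add]
  refine mul_le_mul_of_nonneg_left ?_ (Real.exp_pos _).le
  rcases abs_cases (l i : ℝ) with ⟨h1, -⟩ | ⟨h1, -⟩ <;> rw [h1]
  · refine le_add_of_nonneg_of_le (Real.exp_pos _).le (Real.exp_le_exp.mpr ?_)
    linarith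
  · refine le_add_of_le_of_nonneg (Real.exp_le_exp.mpr ?_) (Real.exp_pos _).le
    linarith

lemma tendsto_atImInfty_of_hasSum {f : ℍ → ℂ} {c : ℕ → ℂ}
    (h : ∀ τ : ℍ, HasSum (fun n => c n * Complex.exp (2 * Real.pi * Complex.I * τ) ^ n) (f τ)) :
    Tendsto f atImInfty (𝓝 (c 0)) := by
  have h1 : ∀ (τ : ℍ) (z : ℂ), HasSum (fun n : ℕ => c n *
      Complex.exp (2 * Real.pi * Complex.I * ((n : ℂ) * τ + ((0 : ℚ) : ℂ) * z))) (f τ) := by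
    intro τ z
    refine (h τ).congr_fun fun n => ?_
    rw [← Complex.exp_nat_mul, Rat.cast_zero, zero_mul, add_zero, mul_left_comm]
  have h0 : ∀ z : ℂ, HasSum (fun n : ℕ => if n = 0 then c n *
      Complex.exp (2 * Real.pi * Complex.I * (((0 : ℚ) : ℂ) * z)) else 0) (c 0) := by
    intro z
    refine (hasSum_ite_eq 0 (c 0)).congr_fun fun n => ?_
    split_ifs with hn
    · rw [hn, Rat.cast_zero, zero_mul, mul_zero, Complex.exp_zero, mul_one]
    · rfl
  have := tendstoLocallyUniformly_of_hasSum (N := fun n => n) (l := fun _ => 0)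
    (ψ := fun τ _ => f τ) (ψ₀ := fun _ => c 0) h1 h0
  exact (tendstoLocallyUniformlyOn_univ.mpr this).tendsto_at (mem_univ 0)

lemma tendsto_E2_atImInfty : Tendsto EisensteinSeries.E2 atImInfty (𝓝 1) :=
  tendsto_atImInfty_of_hasSum fun τ => EisensteinSeries.hasSum_qExpansion_E2 (z := τ)

lemma exists_tendsto_atImInfty {k : ℤ} (f : ModularForm 𝒮ℒ k) :
    ∃ c, Tendsto f atImInfty (𝓝 c) := by
  refine ⟨_, tendsto_atImInfty_of_hasSum (c := fun n => (qExpansion 1 f).coeff n) fun τ => ?_⟩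
  simpa only [Function.Periodic.qParam, Complex.ofReal_one, div_one, smul_eq_mul] using
    UpperHalfPlane.hasSum_qExpansion one_pos
      (SlashInvariantFormClass.periodic_comp_ofComplex f (by simp)) (ModularFormClass.holo f)
      (ModularFormClass.bdd_at_infty f) τ

/-! ### The modular heat operator -/

/-- The coefficient of `∂²/∂z²` in the heat operator of index `M / 2`, up to sign. -/
def heatCoeff (M : ℕ) : ℂ := 3 / ((M : ℂ) / 2) * ((2 * Real.pi * Complex.I) ^ 2)⁻¹

lemma heatCoeff_ne_zero {M : ℕ} (hM : 0 < M) : heatCoeff M ≠ 0 := by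
  have : (M : ℂ) ≠ 0 := by exact_mod_cast hM.ne'
  simp [heatCoeff, this, Real.pi_ne_zero]

lemma modularHeat_eq (M : ℕ) (k : ℤ) (ψ : ℍ → ℂ → ℂ) :
    modularHeat M k ψ = fun τ z => 12 * dTau ψ τ z - heatCoeff M * dZ (dZ ψ) τ z -
      (2 * (k : ℂ) - 1) / 2 * (EisensteinSeries.E2 τ * ψ τ z) := by
  funext τ z
  have h : iteratedDeriv 2 (ψ τ) z = dZ (dZ ψ) τ z := by
    rw [iteratedDeriv_succ, iteratedDeriv_one]
    rfl
  simp only [modularHeat, heat, h, heatCoeff, dTau]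
  ring

/-- The constant-coefficient operator on functions of `z` that `H_k` induces on limits at the
cusp. -/
def cuspHeat (M : ℕ) (k : ℤ) (g : ℂ → ℂ) : ℂ → ℂ := fun z =>
  -heatCoeff M * deriv (deriv g) z - (2 * (k : ℂ) - 1) / 2 * g z

lemma IsHolo.modularHeat {ψ : ℍ → ℂ → ℂ} (h : IsHolo ψ) (M : ℕ) (k : ℤ) :
    IsHolo (modularHeat M k ψ) := by
  rw [modularHeat_eq]
  exact ((h.dTau.const_mul _).sub (h.dZ.dZ.const_mul _)).sub
    (((IsHolo.of_mdifferentiable E2_mdifferentiable).mul h).const_mul _)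

lemma HasCuspLimit.const_mul {ψ : ℍ → ℂ → ℂ} {ψ₀ : ℂ → ℂ} (h : HasCuspLimit ψ ψ₀) (c : ℂ) :
    HasCuspLimit (fun τ z => c * ψ τ z) (fun z => c * ψ₀ z) :=
  (HasCuspLimit.const c).mul h

lemma HasCuspLimit.modularHeat {ψ : ℍ → ℂ → ℂ} {ψ₀ : ℂ → ℂ} (h : HasCuspLimit ψ ψ₀) (M : ℕ)
    (k : ℤ) : HasCuspLimit (modularHeat M k ψ) (cuspHeat M k ψ₀) := by
  rw [modularHeat_eq]
  have hE := HasCuspLimit.of_tendsto E2_mdifferentiable tendsto_E2_atImInfty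
  convert ((h.dTau.const_mul 12).sub (h.dZ.dZ.const_mul (heatCoeff M))).sub
    ((hE.mul h).const_mul ((2 * (k : ℂ) - 1) / 2)) using 1
  funext z
  simp [cuspHeat]

/-- The equation satisfied by the `q⁰`-part of a solution. -/
theorem exists_cuspHeat_eq_zero {M : ℕ} {k : ℤ} {lam₁ lam₂ : ℂ} {φ : ℍ → ℂ → ℂ} {φ₀ : ℂ → ℂ}
    (h : HasCuspLimit φ φ₀) (hmde : SolvesMDE3 M k lam₁ lam₂ φ) : ∃ μ₁ μ₂ : ℂ, ∀ z,
      cuspHeat M (k + 4) (cuspHeat M (k + 2) (cuspHeat M k φ₀)) z + μ₁ * cuspHeat M k φ₀ z +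
        μ₂ * φ₀ z = 0 := by
  obtain ⟨e₄, h₄⟩ := exists_tendsto_atImInfty ModularForm.E₄
  obtain ⟨e₆, h₆⟩ := exists_tendsto_atImInfty ModularForm.E₆
  refine ⟨lam₁ * e₄, lam₂ * e₆, fun z => ?_⟩
  have h3 : HasCuspLimit (modularHeatIter M k 3 φ)
      (cuspHeat M (k + 4) (cuspHeat M (k + 2) (cuspHeat M k φ₀))) := by
    have := ((h.modularHeat M k).modularHeat M (k + 2)).modularHeat M (k + 4)
    simpa [modularHeatIter] using this
  have ht := ((h3.tendsto z).add (((h₄.const_mul lam₁)).mul ((h.modularHeat M k).tendsto z))).add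
    ((h₆.const_mul lam₂).mul (h.tendsto z))
  exact tendsto_nhds_unique (ht.congr fun τ => hmde τ z) tendsto_const_nhds

/-! ### Taylor coefficients at `z = 0` -/

/-- The `n`-th Taylor coefficient of `ψ` at `z = 0`, times `n!`, as a function of `τ`. -/
def taylorCoeff (ψ : ℍ → ℂ → ℂ) (n : ℕ) : ℍ → ℂ := fun τ => iteratedDeriv n (ψ τ) 0

lemma taylorCoeff_eq_iterate (ψ : ℍ → ℂ → ℂ) (n : ℕ) :
    taylorCoeff ψ n = fun τ => (dZ^[n] ψ) τ 0 := by
  funext τ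
  have key : deriv^[n] (ψ τ) = (dZ^[n] ψ) τ := by
    induction n with
    | zero => rfl
    | succ n ih => rw [Function.iterate_succ_apply', ih, Function.iterate_succ_apply']; rfl
  rw [taylorCoeff, iteratedDeriv_eq_iterate, key]

lemma taylorCoeff_dZ (ψ : ℍ → ℂ → ℂ) (n : ℕ) : taylorCoeff (dZ ψ) n = taylorCoeff ψ (n + 1) := by
  simp only [taylorCoeff_eq_iterate, Function.iterate_succ_apply]

lemma IsHolo.iterate_dZ {ψ : ℍ → ℂ → ℂ} (h : IsHolo ψ) (n : ℕ) : IsHolo (JacobiMDE.dZ^[n] ψ) := by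
  induction n with
  | zero => exact h
  | succ n ih => rw [Function.iterate_succ_apply']; exact ih.dZ

lemma IsHolo.contDiffAt {ψ : ℍ → ℂ → ℂ} (h : IsHolo ψ) (τ : ℍ) {n : WithTop ℕ∞} {z : ℂ} :
    ContDiffAt ℂ n (ψ τ) z :=
  (h.differentiable τ).contDiff.contDiffAt

lemma IsHolo.mdifferentiable_taylorCoeff {ψ : ℍ → ℂ → ℂ} (h : IsHolo ψ) (n : ℕ) :
    MDiff (taylorCoeff ψ n) := by
  rw [taylorCoeff_eq_iterate]
  exact (h.iterate_dZ n).mdifferentiable 0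

lemma IsHolo.taylorCoeff_dTau {ψ : ℍ → ℂ → ℂ} (h : IsHolo ψ) (n : ℕ) :
    taylorCoeff (JacobiMDE.dTau ψ) n =
      Derivative.normalizedDerivOfComplex (taylorCoeff ψ n) := by
  have key : JacobiMDE.dZ^[n] (JacobiMDE.dTau ψ) = JacobiMDE.dTau (JacobiMDE.dZ^[n] ψ) := by
    induction n with
    | zero => rfl
    | succ n ih =>
      rw [Function.iterate_succ_apply', ih, (h.iterate_dZ n).dZ_dTau, Function.iterate_succ_apply']
  rw [taylorCoeff_eq_iterate, key, taylorCoeff_eq_iterate]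
  rfl

lemma HasCuspLimit.tendsto_taylorCoeff {ψ : ℍ → ℂ → ℂ} {ψ₀ : ℂ → ℂ} (h : HasCuspLimit ψ ψ₀)
    (n : ℕ) : Tendsto (taylorCoeff ψ n) atImInfty (𝓝 (iteratedDeriv n ψ₀ 0)) := by
  rw [taylorCoeff_eq_iterate, iteratedDeriv_eq_iterate]
  have key : HasCuspLimit (JacobiMDE.dZ^[n] ψ) (deriv^[n] ψ₀) := by
    induction n with
    | zero => exact h
    | succ n ih => rw [Function.iterate_succ_apply', Function.iterate_succ_apply']; exact ih.dZ
  exact key.tendsto 0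

lemma IsHolo.taylorCoeff_modularHeat {ψ : ℍ → ℂ → ℂ} (h : IsHolo ψ) (M : ℕ) (k : ℤ) (n : ℕ)
    (τ : ℍ) : taylorCoeff (JacobiMDE.modularHeat M k ψ) n τ =
      12 * Derivative.normalizedDerivOfComplex (taylorCoeff ψ n) τ -
        heatCoeff M * taylorCoeff ψ (n + 2) τ -
        (2 * (k : ℂ) - 1) / 2 * (EisensteinSeries.E2 τ * taylorCoeff ψ n τ) := by
  rw [← h.taylorCoeff_dTau, ← taylorCoeff_dZ, ← taylorCoeff_dZ, modularHeat_eq]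
  have cd : ∀ {χ : ℍ → ℂ → ℂ}, IsHolo χ → ContDiffAt ℂ n (χ τ) 0 := fun hχ => hχ.contDiffAt τ
  simp only [taylorCoeff]
  rw [iteratedDeriv_fun_sub
      ((contDiffAt_const.mul (cd h.dTau)).sub (contDiffAt_const.mul (cd h.dZ.dZ)))
      (contDiffAt_const.mul (contDiffAt_const.mul (cd h))),
    iteratedDeriv_fun_sub (contDiffAt_const.mul (cd h.dTau))
      (contDiffAt_const.mul (cd h.dZ.dZ))]
  simp only [iteratedDeriv_const_mul_field]

/-- `ψ` vanishes to order at least `n` along `z = 0`. -/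
def VanishesToOrder (ψ : ℍ → ℂ → ℂ) (n : ℕ) : Prop := ∀ j < n, taylorCoeff ψ j = 0

lemma VanishesToOrder.mono {ψ : ℍ → ℂ → ℂ} {m n : ℕ} (h : VanishesToOrder ψ n) (hmn : m ≤ n) :
    VanishesToOrder ψ m := fun j hj => h j (hj.trans_le hmn)

lemma VanishesToOrder.succ {ψ : ℍ → ℂ → ℂ} {n : ℕ} (h : VanishesToOrder ψ n)
    (hn : taylorCoeff ψ n = 0) : VanishesToOrder ψ (n + 1) := fun j hj => by
  rcases Nat.lt_succ_iff_lt_or_eq.mp hj with hj | rfl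
  exacts [h j hj, hn]

/-- `H_k` lowers the order of vanishing by at most two, and only its term `∂²/∂z²` contributes to
the new leading coefficient. -/
lemma VanishesToOrder.modularHeat {ψ : ℍ → ℂ → ℂ} (hψ : IsHolo ψ) {n : ℕ}
    (h : VanishesToOrder ψ (n + 2)) (M : ℕ) (k : ℤ) :
    (∀ j ≤ n, taylorCoeff (modularHeat M k ψ) j = fun τ => -heatCoeff M * taylorCoeff ψ (j + 2) τ) ∧
      VanishesToOrder (modularHeat M k ψ) n := by
  have h1 : ∀ j ≤ n, taylorCoeff (JacobiMDE.modularHeat M k ψ) j =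
      fun τ => -heatCoeff M * taylorCoeff ψ (j + 2) τ := fun j hj => by
    funext τ
    have hD : Derivative.normalizedDerivOfComplex (0 : ℍ → ℂ) = 0 :=
      Derivative.normalizedDerivOfComplex_const 0
    rw [hψ.taylorCoeff_modularHeat, h j (by omega), hD]
    simp
  refine ⟨h1, fun j hj => ?_⟩
  rw [h1 j hj.le, h (j + 2) (by omega)]
  funext τ
  simp

/-- A solution of the third-order equation is determined by its Taylor coefficients at `z = 0` of
order at most `5`: comparing the coefficients of `z ^ n` in the equation expresses the coefficient
of order `n + 6` through lower ones. -/
theorem eq_zero_of_vanishesToOrder_six {M : ℕ} (hM : 0 < M) {k : ℤ} {lam₁ lam₂ : ℂ}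
    {φ : ℍ → ℂ → ℂ} (hφ : IsHolo φ) (hmde : SolvesMDE3 M k lam₁ lam₂ φ)
    (h : VanishesToOrder φ 6) : φ = 0 := by
  have hstep : ∀ n, VanishesToOrder φ (n + 6) := by
    intro n
    induction n with
    | zero => exact h
    | succ n ih =>
      rw [show n + 1 + 6 = n + 6 + 1 by ring]
      refine ih.succ ?_
      have i1 := hφ.modularHeat M k
      have i2 := i1.modularHeat M (k + 2)
      obtain ⟨c1, v1⟩ := VanishesToOrder.modularHeat hφ (n := n + 4) ih M k
      obtain ⟨c2, v2⟩ := VanishesToOrder.modularHeat i1 (n := n + 2) v1 M (k + 2)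
      obtain ⟨c3, -⟩ := VanishesToOrder.modularHeat i2 (n := n) v2 M (k + 4)
      have hiter : modularHeatIter M k 3 φ =
          modularHeat M (k + 4) (modularHeat M (k + 2) (modularHeat M k φ)) := by
        simp [modularHeatIter]
      have i3 := i2.modularHeat M (k + 4)
      funext τ
      have heq : (fun z => modularHeatIter M k 3 φ τ z +
          lam₁ * ModularForm.E₄ τ * modularHeat M k φ τ z + lam₂ * ModularForm.E₆ τ * φ τ z) =
          fun _ => 0 := funext fun z => hmde τ z
      have hz := congrArg (fun g => iteratedDeriv n g 0) heq
      have cd : ∀ {χ : ℍ → ℂ → ℂ}, IsHolo χ → ContDiffAt ℂ n (χ τ) 0 := fun hχ =>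
        hχ.contDiffAt τ
      simp only [hiter] at hz
      rw [iteratedDeriv_fun_add
          ((cd i3).add (contDiffAt_const.mul (cd i1)))
          (contDiffAt_const.mul (cd hφ)),
        iteratedDeriv_fun_add (cd i3) (contDiffAt_const.mul (cd i1)),
        iteratedDeriv_const_mul_field, iteratedDeriv_const_mul_field] at hz
      have t3 := congrFun (c3 n le_rfl) τ
      have t2 := congrFun (c2 (n + 2) le_rfl) τ
      have t1 := congrFun (c1 (n + 4) le_rfl) τ
      have t1' := congrFun (v1 n (by omega)) τ
      have t0 := congrFun (ih n (by omega)) τ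
      simp only [taylorCoeff] at t3 t2 t1 t1' t0
      rw [t3, t2, t1, t1', t0] at hz
      have hc := heatCoeff_ne_zero hM
      have h0 : iteratedDeriv n (fun _ : ℂ => (0 : ℂ)) 0 = 0 := by
        simp
      rw [h0] at hz
      have hz' : iteratedDeriv (n + 4 + 2) (φ τ) 0 = 0 := by simpa [hc] using hz
      exact hz'
  have hall : ∀ n, taylorCoeff φ n = 0 := fun n => hstep n n (by omega)
  funext τ z
  rw [← Complex.taylorSeries_eq_of_entire' 0 z (hφ.differentiable τ)]
  have : ∀ n, iteratedDeriv n (φ τ) 0 = 0 := fun n => congrFun (hall n) τ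
  simp [this]

/-! ### Modularity of the leading Taylor coefficient -/

lemma iteratedDeriv_mul_of_forall_lt_eq_zero {g h : ℂ → ℂ} (hg : Differentiable ℂ g)
    (hh : Differentiable ℂ h) {n : ℕ} {c : ℂ} (h0 : ∀ j < n, iteratedDeriv j h c = 0) :
    iteratedDeriv n (fun z => g z * h z) c = g c * iteratedDeriv n h c := by
  induction n generalizing g h with
  | zero => simp
  | succ n ih =>
    have hg' : Differentiable ℂ (deriv g) := hg.deriv
    have hh' : Differentiable ℂ (deriv h) := hh.deriv
    have hd : deriv (fun z => g z * h z) = fun z => deriv g z * h z + g z * deriv h z :=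
      funext fun z => deriv_fun_mul (hg z) (hh z)
    rw [iteratedDeriv_succ', hd, iteratedDeriv_fun_add (hg'.fun_mul hh).contDiff.contDiffAt
      (hg.fun_mul hh').contDiff.contDiffAt, ih hg' hh fun j hj => h0 j (by omega),
      ih hg hh' fun j hj => by rw [← iteratedDeriv_succ']; exact h0 (j + 1) (by omega),
      h0 n n.lt_succ_self, mul_zero, zero_add, iteratedDeriv_succ']

theorem IsWeakJacobiForm.isHolo {k : ℤ} {M : ℕ} {φ : ℍ → ℂ → ℂ} (hφ : IsWeakJacobiForm k M φ) :
    IsHolo φ := hφ.holo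

/-- If a weak Jacobi form vanishes to order `n` along `z = 0`, its `n`-th Taylor coefficient
transforms like a modular form of weight `k + n`. -/
theorem IsWeakJacobiForm.taylorCoeff_smul {k : ℤ} {M : ℕ} {φ : ℍ → ℂ → ℂ}
    (hφ : IsWeakJacobiForm k M φ) {n : ℕ} (hn : VanishesToOrder φ n) (γ : SL(2, ℤ)) (τ : ℍ) :
    taylorCoeff φ n (γ • τ) = ((γ 1 0 : ℂ) * τ + (γ 1 1 : ℂ)) ^ (k + n) * taylorCoeff φ n τ := by
  set J : ℂ := (γ 1 0 : ℂ) * τ + (γ 1 1 : ℂ) with hJ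
  have hJ0 : J ≠ 0 := by
    have := denom_ne_zero (γ : GL (Fin 2) ℝ) τ
    rwa [ModularGroup.denom_apply] at this
  have heq : (fun z => φ (γ • τ) (J⁻¹ * z)) = fun z => (J ^ k *
      Complex.exp (2 * Real.pi * Complex.I * ((M : ℂ) / 2) * ((γ 1 0 : ℂ) * z ^ 2 / J))) *
        φ τ z := by
    funext z
    rw [← hφ.modular γ τ z, ← hJ, div_eq_inv_mul]
  have h1 := congrFun (iteratedDeriv_comp_const_mul (n := n) (f := φ (γ • τ))
    (hφ.isHolo.differentiable _).contDiff J⁻¹) 0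
  rw [heq, iteratedDeriv_mul_of_forall_lt_eq_zero (by fun_prop) (hφ.isHolo.differentiable τ)
    fun j hj => congrFun (hn j hj) τ] at h1
  simp only [mul_zero, ne_eq, OfNat.ofNat_ne_zero, not_false_eq_true, zero_pow, zero_div,
    Complex.exp_zero, mul_one, inv_pow] at h1
  rw [taylorCoeff, taylorCoeff, zpow_add₀ hJ0, zpow_natCast, mul_right_comm, h1]
  field_simp

/-- The leading Taylor coefficient of a weak Jacobi form is a modular form. -/
theorem IsWeakJacobiForm.exists_modularForm {k : ℤ} {M : ℕ} {φ : ℍ → ℂ → ℂ}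
    (hφ : IsWeakJacobiForm k M φ) {φ₀ : ℂ → ℂ} (hlim : HasCuspLimit φ φ₀) {n : ℕ}
    (hn : VanishesToOrder φ n) :
    ∃ f : ModularForm 𝒮ℒ (k + n), ⇑f = taylorCoeff φ n := by
  have hslash : ∀ γ : SL(2, ℤ), SlashAction.map (k + n : ℤ) γ (taylorCoeff φ n) =
      taylorCoeff φ n := by
    intro γ
    funext τ
    have hJ0 := denom_ne_zero (γ : GL (Fin 2) ℝ) τ
    rw [ModularForm.SL_slash_apply, hφ.taylorCoeff_smul hn, zpow_neg]
    rw [ModularGroup.denom_apply] at hJ0 ⊢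
    rw [mul_right_comm, mul_inv_cancel₀ (zpow_ne_zero _ hJ0), one_mul]
  refine ⟨⟨⟨taylorCoeff φ n, ?_⟩, hφ.isHolo.mdifferentiable_taylorCoeff n, ?_⟩, rfl⟩
  · rintro _ ⟨γ, rfl⟩
    exact hslash γ
  · intro c hc
    rw [Subgroup.IsArithmetic.isCusp_iff_isCusp_SL2Z] at hc
    rw [OnePoint.isBoundedAt_iff_forall_SL2Z hc]
    intro γ _
    rw [hslash γ]
    exact (hlim.tendsto_taylorCoeff n).isBigO_one ℝ

/-- Level one modular forms of negative weight, of odd weight and of weight two vanish. -/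
lemma modularForm_eq_zero {w : ℤ} (hw : w < 0 ∨ Odd w ∨ w = 2) (f : ModularForm 𝒮ℒ w) :
    ⇑f = 0 := by
  rcases hw with hw | hw | rfl
  · exact ModularFormClass.levelOne_neg_weight_eq_zero hw f
  · rw [ModularForm.levelOne_odd_weight_eq_zero hw f]
    rfl
  · rw [rank_zero_iff_forall_zero.mp ModularForm.levelOne_weight_two_rank_zero f]
    rfl

/-- The order of vanishing along `z = 0` increases when the weight of the leading Taylor
coefficient admits no nonzero modular form. -/
theorem IsWeakJacobiForm.vanishesToOrder_succ {k : ℤ} {M : ℕ} {φ : ℍ → ℂ → ℂ}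
    (hφ : IsWeakJacobiForm k M φ) {φ₀ : ℂ → ℂ} (hlim : HasCuspLimit φ φ₀) {n : ℕ}
    (hn : VanishesToOrder φ n) (hw : k + n < 0 ∨ Odd (k + n) ∨ k + n = 2) :
    VanishesToOrder φ (n + 1) := by
  obtain ⟨f, hf⟩ := hφ.exists_modularForm hlim hn
  exact hn.succ (hf ▸ modularForm_eq_zero hw f)

lemma IsWeakJacobiForm.vanishesToOrder_of_neg {k : ℤ} {M : ℕ} {φ : ℍ → ℂ → ℂ}
    (hφ : IsWeakJacobiForm k M φ) {φ₀ : ℂ → ℂ} (hlim : HasCuspLimit φ φ₀) (n : ℕ)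
    (hk : k + n ≤ 0) : VanishesToOrder φ n := by
  induction n with
  | zero => exact fun j hj => absurd hj (Nat.not_lt_zero j)
  | succ n ih =>
    push_cast at hk
    exact hφ.vanishesToOrder_succ hlim (ih (by omega)) (Or.inl (by omega))

/-- A leading Taylor coefficient of weight zero is constant, so it vanishes if its limit does. -/
theorem IsWeakJacobiForm.vanishesToOrder_succ_of_weight_zero {k : ℤ} {M : ℕ} {φ : ℍ → ℂ → ℂ}
    (hφ : IsWeakJacobiForm k M φ) {φ₀ : ℂ → ℂ} (hlim : HasCuspLimit φ φ₀) {n : ℕ}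
    (hn : VanishesToOrder φ n) (hw : k + n = 0) (h0 : iteratedDeriv n φ₀ 0 = 0) :
    VanishesToOrder φ (n + 1) := by
  obtain ⟨f, hf⟩ := hφ.exists_modularForm hlim hn
  obtain ⟨c, hc⟩ : ∃ c, ⇑f = Function.const ℍ c := by
    clear hf
    generalize k + (n : ℤ) = w at hw f
    subst hw
    exact ModularFormClass.levelOne_weight_zero_const f
  have hlim' := hlim.tendsto_taylorCoeff n
  rw [h0, ← hf, hc] at hlim'
  have hc0 : c = 0 := tendsto_nhds_unique tendsto_const_nhds hlim'
  refine hn.succ ?_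
  rw [← hf, hc, hc0]
  rfl

lemma VanishesToOrder.iteratedDeriv_limit {φ : ℍ → ℂ → ℂ} {φ₀ : ℂ → ℂ} (hlim : HasCuspLimit φ φ₀)
    {n : ℕ} (hn : VanishesToOrder φ n) : ∀ j < n, iteratedDeriv j φ₀ 0 = 0 := fun j hj => by
  have h := hlim.tendsto_taylorCoeff j
  rw [hn j hj] at h
  exact tendsto_nhds_unique h tendsto_const_nhds

/-! ### Fourier coefficients of the `q⁰`-part -/

/-- The Fourier integral `∫₀² g(x) exp(-πirx) dx` of a function of period `2`. -/
def fourierInt (r : ℤ) (g : ℂ → ℂ) : ℂ :=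
  ∫ x in (0 : ℝ)..2, g x * Complex.exp (-(Real.pi * Complex.I * r) * x)

lemma fourierInt_exp (r s : ℤ) :
    ∫ x in (0 : ℝ)..2, Complex.exp (2 * Real.pi * Complex.I * (((s : ℚ) / 2 : ℚ) * (x : ℂ))) *
      Complex.exp (-(Real.pi * Complex.I * r) * x) = if s = r then 2 else 0 := by
  have h : ∀ x : ℝ, Complex.exp (2 * Real.pi * Complex.I * (((s : ℚ) / 2 : ℚ) * (x : ℂ))) *
      Complex.exp (-(Real.pi * Complex.I * r) * x) =
        Complex.exp (Real.pi * Complex.I * ((s : ℂ) - r) * x) := fun x => by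
    rw [← Complex.exp_add]
    congr 1
    push_cast
    ring
  simp only [h]
  split_ifs with hsr
  · simp [hsr]
  · have hc : (Real.pi * Complex.I * ((s : ℂ) - r) : ℂ) ≠ 0 := by
      have : (s : ℂ) - r ≠ 0 := sub_ne_zero.mpr (by exact_mod_cast hsr)
      simp [this, Real.pi_ne_zero]
    rw [integral_exp_mul_complex hc]
    have h2 : (Real.pi * Complex.I * ((s : ℂ) - r) * ((2 : ℝ) : ℂ) : ℂ) =
        ((s - r : ℤ) : ℂ) * (2 * Real.pi * Complex.I) := by
      push_cast
      ring
    rw [h2, Complex.exp_int_mul_two_pi_mul_I]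
    simp

/-- `g(z) = ∑ b(l) exp(2πilz)`, the sum being over `l ∈ ½ℤ` and absolutely convergent
everywhere. -/
structure HasHalfIntegralExpansion (g : ℂ → ℂ) (b : ℚ → ℂ) : Prop where
  support : ∀ l, b l ≠ 0 → ∃ r : ℤ, l = (r : ℚ) / 2
  hasSum : ∀ z : ℂ, HasSum (fun l : ℚ =>
    b l * Complex.exp (2 * Real.pi * Complex.I * ((l : ℂ) * z))) (g z)

namespace HasHalfIntegralExpansion

variable {g : ℂ → ℂ} {b b' : ℚ → ℂ}

theorem fourierInt_eq (h : HasHalfIntegralExpansion g b) (r : ℤ) :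
    fourierInt r g = 2 * b ((r : ℚ) / 2) := by
  have hnorm : ∀ (l : ℚ) (x : ℝ),
      ‖Complex.exp (2 * Real.pi * Complex.I * ((l : ℂ) * (x : ℂ)))‖ = 1 := fun l x => by
    have : (2 * Real.pi * Complex.I * ((l : ℂ) * (x : ℂ)) : ℂ) =
        ((2 * Real.pi * ((l : ℝ) * x) : ℝ) : ℂ) * Complex.I := by
      push_cast
      ring
    rw [this, Complex.norm_exp_ofReal_mul_I]
  have hnorm' : ∀ x : ℝ, ‖Complex.exp (-(Real.pi * Complex.I * r) * x)‖ = 1 := fun x => by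
    have : (-(Real.pi * Complex.I * r) * x : ℂ) =
        ((-(Real.pi * r * x) : ℝ) : ℂ) * Complex.I := by
      push_cast
      ring
    rw [this, Complex.norm_exp_ofReal_mul_I]
  have hb : Summable fun l => ‖b l‖ := by
    simpa using (h.hasSum 0).summable.norm
  have hint := intervalIntegral.hasSum_integral_of_dominated_convergence
    (μ := MeasureTheory.volume) (a := (0 : ℝ)) (b := 2)
    (F := fun (l : ℚ) (x : ℝ) => b l * Complex.exp (2 * Real.pi * Complex.I * ((l : ℂ) * (x : ℂ))) *
      Complex.exp (-(Real.pi * Complex.I * r) * x))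
    (f := fun x : ℝ => g x * Complex.exp (-(Real.pi * Complex.I * r) * x))
    (fun l _ => ‖b l‖) (fun l => Continuous.aestronglyMeasurable (by fun_prop))
    (fun l => Eventually.of_forall fun x _ => by
      rw [norm_mul, norm_mul, hnorm, hnorm', mul_one, mul_one])
    (Eventually.of_forall fun x _ => hb) (by simp)
    (Eventually.of_forall fun x _ => (h.hasSum x).mul_right _)
  refine hint.unique ?_
  refine (hasSum_ite_eq ((r : ℚ) / 2) (2 * b ((r : ℚ) / 2))).congr_fun fun l => ?_
  by_cases hl : b l = 0
  · split_ifs with hlr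
    · rw [← hlr]
      simp [hl]
    · simp [hl]
  obtain ⟨s, rfl⟩ := h.support l hl
  simp only [mul_assoc (b _)]
  rw [intervalIntegral.integral_const_mul, fourierInt_exp]
  by_cases hsr : s = r
  · simp [hsr, mul_comm]
  · have : (s : ℚ) / 2 ≠ (r : ℚ) / 2 := fun h' => hsr (by
      field_simp at h'
      exact_mod_cast h')
    simp [hsr, this]

theorem unique (h : HasHalfIntegralExpansion g b) (h' : HasHalfIntegralExpansion g b') :
    b = b' := by
  have key : ∀ r : ℤ, b ((r : ℚ) / 2) = b' ((r : ℚ) / 2) := fun r =>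
    mul_left_cancel₀ two_ne_zero ((h.fourierInt_eq r).symm.trans (h'.fourierInt_eq r))
  funext l
  by_cases hl : b l = 0
  · by_cases hl' : b' l = 0
    · rw [hl, hl']
    · obtain ⟨r, rfl⟩ := h'.support l hl'
      exact key r
  · obtain ⟨r, rfl⟩ := h.support l hl
    exact key r

lemma periodic (h : HasHalfIntegralExpansion g b) : Function.Periodic g 2 := fun z => by
  refine (h.hasSum (z + 2)).unique ((h.hasSum z).congr_fun fun l => ?_)
  by_cases hl : b l = 0
  · simp [hl]
  obtain ⟨r, rfl⟩ := h.support l hl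
  congr 1
  rw [Complex.exp_eq_exp_iff_exists_int]
  exact ⟨r, by push_cast; ring⟩

lemma const_mul (h : HasHalfIntegralExpansion g b) (c : ℂ) :
    HasHalfIntegralExpansion (fun z => c * g z) (fun l => c * b l) where
  support l hl := h.support l (right_ne_zero_of_mul hl)
  hasSum z := by simpa only [mul_assoc] using (h.hasSum z).mul_left c

lemma comp_neg (h : HasHalfIntegralExpansion g b) :
    HasHalfIntegralExpansion (fun z => g (-z)) (fun l => b (-l)) where
  support l hl := by
    obtain ⟨r, hr⟩ := h.support (-l) hl
    exact ⟨-r, by push_cast; linarith⟩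
  hasSum z := by
    refine ((Equiv.neg ℚ).hasSum_iff.mpr (h.hasSum (-z))).congr_fun fun l => ?_
    simp

lemma comp_add_one (h : HasHalfIntegralExpansion g b) :
    HasHalfIntegralExpansion (fun z => g (z + 1))
      (fun l => b l * Complex.exp (2 * Real.pi * Complex.I * l)) where
  support l hl := h.support l (left_ne_zero_of_mul hl)
  hasSum z := by
    refine (h.hasSum (z + 1)).congr_fun fun l => ?_
    rw [mul_assoc, ← Complex.exp_add]
    congr 2
    ring

end HasHalfIntegralExpansion

lemma fourierInt_deriv {g : ℂ → ℂ} (hg : Differentiable ℂ g) (hp : Function.Periodic g 2) (r : ℤ) :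
    fourierInt r (deriv g) = Real.pi * Complex.I * r * fourierInt r g := by
  have hder : ∀ x : ℝ, HasDerivAt
      (fun x : ℝ => g x * Complex.exp (-(Real.pi * Complex.I * r) * x))
      (deriv g x * Complex.exp (-(Real.pi * Complex.I * r) * x) -
        Real.pi * Complex.I * r * (g x * Complex.exp (-(Real.pi * Complex.I * r) * x))) x := by
    intro x
    have h1 : HasDerivAt (fun z : ℂ => Complex.exp (-(Real.pi * Complex.I * r) * z))
        (Complex.exp (-(Real.pi * Complex.I * r) * x) * (-(Real.pi * Complex.I * r) * 1)) x :=
      ((hasDerivAt_id _).const_mul _).cexp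
    have h2 := ((hg x).hasDerivAt.fun_mul h1).comp_ofReal
    exact h2.congr_deriv (by ring)
  have hc : Continuous g := hg.continuous
  have hc' : Continuous (deriv g) := hg.deriv.continuous
  have hFTC := intervalIntegral.integral_eq_sub_of_hasDerivAt (a := (0 : ℝ)) (b := 2)
    (fun x _ => hder x) (Continuous.intervalIntegrable (by fun_prop) _ _)
  rw [intervalIntegral.integral_sub (Continuous.intervalIntegrable (by fun_prop) _ _)
    (Continuous.intervalIntegrable (by fun_prop) _ _), intervalIntegral.integral_const_mul] at hFTC
  have hend : Complex.exp (-(Real.pi * Complex.I * r) * ((2 : ℝ) : ℂ)) = 1 := by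
    rw [Complex.exp_eq_one_iff]
    exact ⟨-r, by push_cast; ring⟩
  have h20 : g ((2 : ℝ) : ℂ) = g ((0 : ℝ) : ℂ) := by simpa using hp 0
  rw [hend, h20] at hFTC
  simp only [Complex.ofReal_zero, mul_zero, Complex.exp_zero, sub_self] at hFTC
  exact sub_eq_zero.mp hFTC

lemma periodic_deriv {g : ℂ → ℂ} {c : ℂ} (hp : Function.Periodic g c) :
    Function.Periodic (deriv g) c := fun z => by
  rw [← deriv_comp_add_const, funext hp]

lemma differentiable_cuspHeat {g : ℂ → ℂ} (hg : Differentiable ℂ g) (M : ℕ) (k : ℤ) :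
    Differentiable ℂ (cuspHeat M k g) :=
  (hg.deriv.deriv.const_mul _).fun_sub (hg.const_mul _)

lemma periodic_cuspHeat {g : ℂ → ℂ} {c : ℂ} (hp : Function.Periodic g c) (M : ℕ) (k : ℤ) :
    Function.Periodic (cuspHeat M k g) c := fun z => by
  rw [cuspHeat, cuspHeat, hp z, periodic_deriv (periodic_deriv hp) z]

/-- The operator `cuspHeat` acts on the coefficient of `ζ^(r/2)` by a scalar. -/
lemma fourierInt_cuspHeat {g : ℂ → ℂ} (hg : Differentiable ℂ g) (hp : Function.Periodic g 2)
    (M : ℕ) (k r : ℤ) : fourierInt r (cuspHeat M k g) =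
      (-(3 / ((M : ℂ) / 2)) * ((r : ℂ) / 2) ^ 2 - (2 * (k : ℂ) - 1) / 2) * fourierInt r g := by
  have hc : Continuous g := hg.continuous
  have hc' : Continuous (deriv (deriv g)) := hg.deriv.deriv.continuous
  have h2 : fourierInt r (deriv (deriv g)) = (Real.pi * Complex.I * r) ^ 2 * fourierInt r g := by
    rw [fourierInt_deriv hg.deriv (periodic_deriv hp), fourierInt_deriv hg hp]
    ring
  have h3 : fourierInt r (cuspHeat M k g) = -heatCoeff M * fourierInt r (deriv (deriv g)) -
      (2 * (k : ℂ) - 1) / 2 * fourierInt r g := by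
    simp only [fourierInt, cuspHeat, sub_mul, mul_assoc]
    rw [intervalIntegral.integral_sub (Continuous.intervalIntegrable (by fun_prop) _ _)
      (Continuous.intervalIntegrable (by fun_prop) _ _)]
    simp only [intervalIntegral.integral_const_mul]
  rw [h3, h2, heatCoeff]
  have : (Real.pi : ℂ) ≠ 0 := by exact_mod_cast Real.pi_ne_zero
  field_simp

/-! ### The `q⁰`-part of a solution -/

section QZero

variable {k : ℤ} {M : ℕ} {φ : ℍ → ℂ → ℂ} {a : ℕ → ℚ → ℂ}

theorem IsWeakJacobiForm.exists_hasCuspLimit (hφ : IsWeakJacobiForm k M φ)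
    (ha : HasFourierExpansion M φ a) :
    ∃ φ₀, HasCuspLimit φ φ₀ ∧ HasHalfIntegralExpansion φ₀ (a 0) := by
  have hinj : Function.Injective (fun l : ℚ => ((0 : ℕ), l)) := fun l l' h => (Prod.mk.inj h).2
  have hs : ∀ z : ℂ, Summable fun l : ℚ =>
      a 0 l * Complex.exp (2 * Real.pi * Complex.I * ((l : ℂ) * z)) := fun z => by
    simpa [Function.comp_def] using
      (ha.hasSum UpperHalfPlane.I z).summable.comp_injective hinj
  refine ⟨fun z => ∑' l, a 0 l * Complex.exp (2 * Real.pi * Complex.I * ((l : ℂ) * z)),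
    ⟨hφ.isHolo, ?_⟩, fun l hl => ?_, fun z => (hs z).hasSum⟩
  · refine tendstoLocallyUniformly_of_hasSum (c := fun p : ℕ × ℚ => a p.1 p.2)
      (N := fun p => p.1) (l := fun p => p.2) ha.hasSum fun z => ?_
    rw [← Function.Injective.hasSum_iff hinj]
    · simpa [Function.comp_def] using (hs z).hasSum
    · rintro ⟨n, l⟩ hp
      refine if_neg fun hn => hp ⟨l, ?_⟩
      change n = 0 at hn
      rw [hn]
  · obtain ⟨r, hr, -⟩ := ha.support 0 l hl
    exact ⟨r, hr⟩

/-- The action of `-1 ∈ SL₂(ℤ)` makes the `q⁰`-part even or odd, according to the weight. -/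
theorem IsWeakJacobiForm.coeff_zero_neg (hφ : IsWeakJacobiForm k M φ)
    (ha : HasFourierExpansion M φ a) (l : ℚ) : a 0 (-l) = (-1) ^ k * a 0 l := by
  obtain ⟨φ₀, hlim, hexp⟩ := hφ.exists_hasCuspLimit ha
  have h1 : ∀ τ z, φ τ (-z) = (-1) ^ k * φ τ z := fun τ z => by
    have := hφ.modular (-1) τ z
    rw [ModularGroup.SL_neg_smul, one_smul] at this
    simpa [div_neg] using this
  have h2 : (fun z => φ₀ (-z)) = fun z => (-1) ^ k * φ₀ z := funext fun z =>
    tendsto_nhds_unique (hlim.tendsto (-z))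
      (((hlim.tendsto z).const_mul _).congr fun τ => (h1 τ z).symm)
  have h3 := hexp.comp_neg
  rw [h2] at h3
  exact congrFun (h3.unique (hexp.const_mul _)) l

/-- For an integral index, translation by `1` forces the exponents to be integral. -/
theorem IsWeakJacobiForm.exists_int_of_coeff_zero_ne_zero (hφ : IsWeakJacobiForm k M φ)
    (ha : HasFourierExpansion M φ a) (hM : Even M) {l : ℚ} (hl : a 0 l ≠ 0) : ∃ n : ℤ, l = n := by
  obtain ⟨φ₀, hlim, hexp⟩ := hφ.exists_hasCuspLimit ha
  have h1 : ∀ τ z, φ τ (z + 1) = φ τ z := fun τ z => by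
    have := hφ.elliptic 0 1 τ z
    simpa [hM.neg_one_pow] using this
  have h2 : (fun z => φ₀ (z + 1)) = φ₀ := funext fun z =>
    tendsto_nhds_unique (hlim.tendsto (z + 1)) ((hlim.tendsto z).congr fun τ => (h1 τ z).symm)
  have h3 := hexp.comp_add_one
  rw [h2] at h3
  have h4 : Complex.exp (2 * Real.pi * Complex.I * l) = 1 :=
    (mul_eq_left₀ hl).mp (congrFun (h3.unique hexp) l)
  obtain ⟨n, hn⟩ := Complex.exp_eq_one_iff.mp h4
  refine ⟨n, ?_⟩
  rw [mul_comm] at hn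
  exact_mod_cast mul_right_cancel₀ Complex.two_pi_I_ne_zero hn

/-- The indicial equation: `-3l²/m` is a root of a fixed cubic for every exponent `l` of the
`q⁰`-part. -/
theorem IsWeakJacobiForm.indicial_equation {lam₁ lam₂ : ℂ} (hφ : IsWeakJacobiForm k M φ)
    (hmde : SolvesMDE3 M k lam₁ lam₂ φ) (ha : HasFourierExpansion M φ a) :
    ∃ μ₁ μ₂ : ℂ, ∀ l, a 0 l ≠ 0 → ∀ X : ℂ, X = -(3 / ((M : ℂ) / 2)) * (l : ℂ) ^ 2 →
      (X - (2 * k + 7) / 2) * (X - (2 * k + 3) / 2) * (X - (2 * k - 1) / 2) +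
        μ₁ * (X - (2 * k - 1) / 2) + μ₂ = 0 := by
  obtain ⟨φ₀, hlim, hexp⟩ := hφ.exists_hasCuspLimit ha
  obtain ⟨μ₁, μ₂, hμ⟩ := exists_cuspHeat_eq_zero hlim hmde
  refine ⟨μ₁, μ₂, fun l hl X hX => ?_⟩
  obtain ⟨r, rfl⟩ := hexp.support l hl
  have d0 := hlim.differentiable_limit
  have d1 := differentiable_cuspHeat d0 M k
  have d2 := differentiable_cuspHeat d1 M (k + 2)
  have d3 := differentiable_cuspHeat d2 M (k + 4)
  have p0 := hexp.periodic
  have p1 := periodic_cuspHeat p0 M k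
  have p2 := periodic_cuspHeat p1 M (k + 2)
  have c0 := d0.continuous
  have c1 := d1.continuous
  have c3 := d3.continuous
  have hsum : fourierInt r (cuspHeat M (k + 4) (cuspHeat M (k + 2) (cuspHeat M k φ₀))) +
      μ₁ * fourierInt r (cuspHeat M k φ₀) + μ₂ * fourierInt r φ₀ = 0 := by
    simp only [fourierInt]
    rw [← intervalIntegral.integral_const_mul, ← intervalIntegral.integral_const_mul,
      ← intervalIntegral.integral_add (Continuous.intervalIntegrable (by fun_prop) _ _)
        (Continuous.intervalIntegrable (by fun_prop) _ _),
      ← intervalIntegral.integral_add (Continuous.intervalIntegrable (by fun_prop) _ _)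
        (Continuous.intervalIntegrable (by fun_prop) _ _)]
    simp only [← mul_assoc, ← add_mul, hμ, zero_mul, intervalIntegral.integral_zero]
  rw [fourierInt_cuspHeat d2 p2, fourierInt_cuspHeat d1 p1, fourierInt_cuspHeat d0 p0] at hsum
  have hr : fourierInt r φ₀ ≠ 0 := by
    rw [hexp.fourierInt_eq]
    exact mul_ne_zero two_ne_zero hl
  have hX' : -(3 / ((M : ℂ) / 2)) * ((r : ℂ) / 2) ^ 2 = X := by
    rw [hX]
    push_cast
    rfl
  rw [hX'] at hsum
  refine mul_right_cancel₀ hr ?_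
  rw [zero_mul, ← hsum]
  push_cast
  ring

end QZero

/-- The sum of three distinct roots of a monic cubic. -/
lemma add_add_eq_of_cubic {x y z b c d : ℂ} (hxy : x ≠ y) (hxz : x ≠ z) (hyz : y ≠ z)
    (hx : x ^ 3 + b * x ^ 2 + c * x + d = 0) (hy : y ^ 3 + b * y ^ 2 + c * y + d = 0)
    (hz : z ^ 3 + b * z ^ 2 + c * z + d = 0) : x + y + z = -b := by
  have h1 : x ^ 2 + x * y + y ^ 2 + b * (x + y) + c = 0 :=
    mul_left_cancel₀ (sub_ne_zero.mpr hxy) (by linear_combination hx - hy)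
  have h2 : x ^ 2 + x * z + z ^ 2 + b * (x + z) + c = 0 :=
    mul_left_cancel₀ (sub_ne_zero.mpr hxz) (by linear_combination hx - hz)
  have h3 : x + y + z + b = 0 :=
    mul_left_cancel₀ (sub_ne_zero.mpr hyz) (by linear_combination h1 - h2)
  linear_combination h3

/-- Vieta's formula for the indicial equation. -/
theorem IsWeakJacobiForm.sum_sq_exponents {k : ℤ} {M : ℕ} {lam₁ lam₂ : ℂ} {φ : ℍ → ℂ → ℂ}
    {a : ℕ → ℚ → ℂ} (hφ : IsWeakJacobiForm k M φ) (hM : 0 < M)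
    (hmde : SolvesMDE3 M k lam₁ lam₂ φ) (ha : HasFourierExpansion M φ a) {l₁ l₂ l₃ : ℚ}
    (h₁ : a 0 l₁ ≠ 0) (h₂ : a 0 l₂ ≠ 0) (h₃ : a 0 l₃ ≠ 0) (h₁₂ : |l₁| ≠ |l₂|)
    (h₁₃ : |l₁| ≠ |l₃|) (h₂₃ : |l₂| ≠ |l₃|) :
    l₁ ^ 2 + l₂ ^ 2 + l₃ ^ 2 = -((2 * (k : ℚ) + 3) / 2) * ((M : ℚ) / 2) := by
  obtain ⟨μ₁, μ₂, h⟩ := hφ.indicial_equation hmde ha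
  have hM' : (M : ℂ) ≠ 0 := by exact_mod_cast hM.ne'
  have hne : ∀ l l' : ℚ, |l| ≠ |l'| →
      -(3 / ((M : ℂ) / 2)) * (l : ℂ) ^ 2 ≠ -(3 / ((M : ℂ) / 2)) * (l' : ℂ) ^ 2 := by
    intro l l' hl heq
    have hc : -(3 / ((M : ℂ) / 2)) ≠ 0 := by simp [hM']
    have := mul_left_cancel₀ hc heq
    exact hl (sq_eq_sq_iff_abs_eq_abs l l' |>.mp (by exact_mod_cast this))
  have hroot : ∀ l : ℚ, a 0 l ≠ 0 → ∀ X : ℂ, X = -(3 / ((M : ℂ) / 2)) * (l : ℂ) ^ 2 →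
      X ^ 3 + (-((6 * k + 9) / 2)) * X ^ 2 + (((2 * k + 7) / 2) * ((2 * k + 3) / 2) +
        ((2 * k + 7) / 2) * ((2 * k - 1) / 2) + ((2 * k + 3) / 2) * ((2 * k - 1) / 2) + μ₁) * X +
        (-((2 * k + 7) / 2 * ((2 * k + 3) / 2) * ((2 * k - 1) / 2)) - μ₁ * ((2 * k - 1) / 2) +
          μ₂) = 0 := fun l hl X hX => by
    linear_combination h l hl X hX
  have hV := add_add_eq_of_cubic (hne _ _ h₁₂) (hne _ _ h₁₃) (hne _ _ h₂₃)
    (hroot l₁ h₁ _ rfl) (hroot l₂ h₂ _ rfl) (hroot l₃ h₃ _ rfl)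
  have hfin : (l₁ : ℂ) ^ 2 + (l₂ : ℂ) ^ 2 + (l₃ : ℂ) ^ 2 =
      -((2 * (k : ℂ) + 3) / 2) * ((M : ℂ) / 2) := by
    field_simp at hV ⊢
    linear_combination (-1 / 3) * hV
  apply Rat.cast_injective (α := ℂ)
  push_cast
  exact hfin

section Shape

variable {k : ℤ} {M : ℕ} {lam₁ lam₂ : ℂ} {φ : ℍ → ℂ → ℂ} {a : ℕ → ℚ → ℂ}

theorem IsWeakJacobiForm.abs_mem_of_coeff_ne_zero (hφ : IsWeakJacobiForm k M φ) (hM : 0 < M)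
    (hmde : SolvesMDE3 M k lam₁ lam₂ φ) (ha : HasFourierExpansion M φ a) {l₁ l₂ l₃ l : ℚ}
    (h₁ : a 0 l₁ ≠ 0) (h₂ : a 0 l₂ ≠ 0) (h₃ : a 0 l₃ ≠ 0) (h₁₂ : |l₁| ≠ |l₂|)
    (h₁₃ : |l₁| ≠ |l₃|) (h₂₃ : |l₂| ≠ |l₃|) (hl : a 0 l ≠ 0) :
    |l| = |l₁| ∨ |l| = |l₂| ∨ |l| = |l₃| := by
  by_contra! hne
  have e := hφ.sum_sq_exponents hM hmde ha h₁ h₂ h₃ h₁₂ h₁₃ h₂₃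
  have e' := hφ.sum_sq_exponents hM hmde ha h₁ h₂ hl h₁₂ hne.1.symm hne.2.1.symm
  exact hne.2.2 ((sq_eq_sq_iff_abs_eq_abs l l₃).mp (by linarith))

theorem IsWeakJacobiForm.encard_abs_exponents_le (hφ : IsWeakJacobiForm k M φ) (hM : 0 < M)
    (hmde : SolvesMDE3 M k lam₁ lam₂ φ) (ha : HasFourierExpansion M φ a) :
    ((fun l : ℚ => |l|) '' {l : ℚ | a 0 l ≠ 0}).encard ≤ 3 := by
  by_contra! hlt
  obtain ⟨t, hts, ht⟩ := Set.exists_subset_encard_eq hlt.le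
  obtain ⟨x₁, x₂, x₃, h12, h13, h23, rfl⟩ := Set.encard_eq_three.mp ht
  obtain ⟨l₁, h₁, rfl⟩ := hts (show x₁ ∈ _ by simp)
  obtain ⟨l₂, h₂, rfl⟩ := hts (show x₂ ∈ _ by simp)
  obtain ⟨l₃, h₃, rfl⟩ := hts (show x₃ ∈ _ by simp)
  refine hlt.not_ge (ht ▸ Set.encard_le_encard ?_)
  rintro _ ⟨l, hl, rfl⟩
  exact hφ.abs_mem_of_coeff_ne_zero hM hmde ha h₁ h₂ h₃ h12 h13 h23 hl

/-- The formal sum `ζ^l + ε ζ^(-l)`. -/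
def zetaPair (ε : ℂ) (l : ℚ) : ℚ → ℂ := zetaPow l + ε • zetaPow (-l)

lemma zetaPair_apply_of_abs_ne {ε : ℂ} {l l' : ℚ} (h : |l'| ≠ |l|) : zetaPair ε l l' = 0 := by
  have h1 : l' ≠ l := fun h' => h (by rw [h'])
  have h2 : l' ≠ -l := fun h' => h (by rw [h', abs_neg])
  simp [zetaPair, zetaPow, h1, h2]

/-- A function with `b(-l) = ε b(l)` is, on `{l, -l}`, a multiple of `ζ^l + ε ζ^(-l)`; for `l = 0`
the two monomials coincide and the multiple is halved. -/
lemma exists_eq_mul_zetaPair {ε : ℂ} {b : ℚ → ℂ}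
    (hb : ∀ l, b (-l) = ε * b l) {l : ℚ} (hl : b l ≠ 0) :
    ∃ α : ℂ, α ≠ 0 ∧ ∀ l', |l'| = |l| → b l' = α * zetaPair ε l l' := by
  by_cases h0 : l = 0
  · subst h0
    have hε1 : ε = 1 := by
      have := hb 0
      rw [neg_zero] at this
      exact mul_right_cancel₀ hl (by rw [← this, one_mul])
    refine ⟨b 0 / 2, div_ne_zero hl two_ne_zero, fun l' hl' => ?_⟩
    have : l' = 0 := by simpa using hl'
    subst this
    simp [zetaPair, zetaPow, hε1]
    ring
  · have hne : -l ≠ l := fun h => h0 (by linarith)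
    refine ⟨b l, hl, fun l' hl' => ?_⟩
    rcases abs_eq_abs.mp hl' with rfl | rfl
    · simp [zetaPair, zetaPow, hne.symm]
    · rw [hb]
      simp [zetaPair, zetaPow, hne, mul_comm]

/-- The `q⁰`-part when three absolute values of exponents occur. -/
theorem IsWeakJacobiForm.exists_coeff_zero_eq (hφ : IsWeakJacobiForm k M φ) (hM : 0 < M)
    (hmde : SolvesMDE3 M k lam₁ lam₂ φ) (ha : HasFourierExpansion M φ a) {l₁ l₂ l₃ : ℚ}
    (h₁ : a 0 l₁ ≠ 0) (h₂ : a 0 l₂ ≠ 0) (h₃ : a 0 l₃ ≠ 0) (h₁₂ : |l₁| ≠ |l₂|)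
    (h₁₃ : |l₁| ≠ |l₃|) (h₂₃ : |l₂| ≠ |l₃|) :
    ∃ α₁ α₂ α₃ : ℂ, α₁ ≠ 0 ∧ a 0 = α₁ • zetaPair ((-1) ^ k) l₁ +
      α₂ • zetaPair ((-1) ^ k) l₂ + α₃ • zetaPair ((-1) ^ k) l₃ := by
  have hb := hφ.coeff_zero_neg ha
  obtain ⟨α₁, hα, e₁⟩ := exists_eq_mul_zetaPair hb h₁
  obtain ⟨α₂, -, e₂⟩ := exists_eq_mul_zetaPair hb h₂
  obtain ⟨α₃, -, e₃⟩ := exists_eq_mul_zetaPair hb h₃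
  refine ⟨α₁, α₂, α₃, hα, funext fun l => ?_⟩
  simp only [Pi.add_apply, Pi.smul_apply, smul_eq_mul]
  by_cases c₁ : |l| = |l₁|
  · rw [e₁ l c₁, zetaPair_apply_of_abs_ne (l := l₂) (by rwa [c₁]),
      zetaPair_apply_of_abs_ne (l := l₃) (by rwa [c₁])]
    ring
  by_cases c₂ : |l| = |l₂|
  · rw [e₂ l c₂, zetaPair_apply_of_abs_ne c₁, zetaPair_apply_of_abs_ne (l := l₃) (by rwa [c₂])]
    ring
  by_cases c₃ : |l| = |l₃|
  · rw [e₃ l c₃, zetaPair_apply_of_abs_ne c₁, zetaPair_apply_of_abs_ne c₂]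
    ring
  rw [zetaPair_apply_of_abs_ne c₁, zetaPair_apply_of_abs_ne c₂, zetaPair_apply_of_abs_ne c₃]
  by_contra hl
  have := hφ.abs_mem_of_coeff_ne_zero hM hmde ha h₁ h₂ h₃ h₁₂ h₁₃ h₂₃ (l := l)
    fun h => hl (by rw [h]; ring)
  tauto

end Shape

/-! ### Taylor coefficients of the `q⁰`-part -/

lemma hasSum_zetaPow (l : ℚ) (z : ℂ) : HasSum (fun l' : ℚ => zetaPow l l' *
    Complex.exp (2 * Real.pi * Complex.I * ((l' : ℂ) * z)))
    (Complex.exp (2 * Real.pi * Complex.I * ((l : ℂ) * z))) := by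
  refine (hasSum_ite_eq l
    (Complex.exp (2 * Real.pi * Complex.I * ((l : ℂ) * z)))).congr_fun fun l' => ?_
  by_cases h : l' = l
  · subst h
    simp [zetaPow]
  · simp [zetaPow, h]

lemma hasSum_zetaPair (ε : ℂ) (l : ℚ) (z : ℂ) : HasSum (fun l' : ℚ => zetaPair ε l l' *
    Complex.exp (2 * Real.pi * Complex.I * ((l' : ℂ) * z)))
    (Complex.exp (2 * Real.pi * Complex.I * l * z) +
      ε * Complex.exp (-(2 * Real.pi * Complex.I * l) * z)) := by
  have h := (hasSum_zetaPow l z).add ((hasSum_zetaPow (-l) z).mul_left ε)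
  convert h.congr_fun fun l' => ?_ using 1
  · push_cast
    ring_nf
  · simp only [zetaPair, Pi.add_apply, Pi.smul_apply, smul_eq_mul]
    ring

lemma iteratedDeriv_exp_pair (ε c : ℂ) (n : ℕ) :
    iteratedDeriv n (fun z : ℂ => Complex.exp (c * z) + ε * Complex.exp (-c * z)) 0 =
      (1 + ε * (-1) ^ n) * c ^ n := by
  rw [iteratedDeriv_fun_add (by fun_prop) (by fun_prop), iteratedDeriv_const_mul_field,
    iteratedDeriv_cexp_const_mul, iteratedDeriv_cexp_const_mul]
  simp only [mul_zero, Complex.exp_zero, mul_one]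
  rw [neg_pow]
  ring

theorem HasHalfIntegralExpansion.iteratedDeriv_eq {g : ℂ → ℂ} {ε α₁ α₂ α₃ : ℂ} {l₁ l₂ l₃ : ℚ}
    (h : HasHalfIntegralExpansion g
      (α₁ • zetaPair ε l₁ + α₂ • zetaPair ε l₂ + α₃ • zetaPair ε l₃)) (n : ℕ) :
    iteratedDeriv n g 0 = (2 * Real.pi * Complex.I) ^ n * (1 + ε * (-1) ^ n) *
      (α₁ * (l₁ : ℂ) ^ n + α₂ * (l₂ : ℂ) ^ n + α₃ * (l₃ : ℂ) ^ n) := by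
  have hg : g = fun z =>
      α₁ * (Complex.exp (2 * Real.pi * Complex.I * l₁ * z) +
        ε * Complex.exp (-(2 * Real.pi * Complex.I * l₁) * z)) +
      α₂ * (Complex.exp (2 * Real.pi * Complex.I * l₂ * z) +
        ε * Complex.exp (-(2 * Real.pi * Complex.I * l₂) * z)) +
      α₃ * (Complex.exp (2 * Real.pi * Complex.I * l₃ * z) +
        ε * Complex.exp (-(2 * Real.pi * Complex.I * l₃) * z)) := by
    funext z
    refine (h.hasSum z).unique (((((hasSum_zetaPair ε l₁ z).mul_left α₁).add
      ((hasSum_zetaPair ε l₂ z).mul_left α₂)).add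
      ((hasSum_zetaPair ε l₃ z).mul_left α₃)).congr_fun fun l => ?_)
    simp only [Pi.add_apply, Pi.smul_apply, smul_eq_mul]
    ring
  rw [hg, iteratedDeriv_fun_add (by fun_prop) (by fun_prop),
    iteratedDeriv_fun_add (by fun_prop) (by fun_prop)]
  simp only [iteratedDeriv_const_mul_field, iteratedDeriv_exp_pair, mul_pow]
  ring

/-! ### Weights and moments -/

section Weights

variable {k : ℤ} {M : ℕ} {lam₁ lam₂ : ℂ} {φ : ℍ → ℂ → ℂ} {φ₀ : ℂ → ℂ}

theorem IsWeakJacobiForm.neg_five_le_weight (hφ : IsWeakJacobiForm k M φ) (hM : 0 < M)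
    (hmde : SolvesMDE3 M k lam₁ lam₂ φ) (hlim : HasCuspLimit φ φ₀) (h0 : φ ≠ 0) : -5 ≤ k := by
  by_contra! hk
  exact h0 (eq_zero_of_vanishesToOrder_six hM hφ.isHolo hmde
    (hφ.vanishesToOrder_of_neg hlim 6 (by push_cast; omega)))

/-- For `k ≤ -2` the Taylor coefficient of weight zero of a nonzero solution survives at the cusp:
otherwise it vanishes, then so do those of weights `1`, `2` and `3`, and the solution is zero. -/
theorem IsWeakJacobiForm.iteratedDeriv_limit_ne_zero (hφ : IsWeakJacobiForm k M φ) (hM : 0 < M)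
    (hmde : SolvesMDE3 M k lam₁ lam₂ φ) (hlim : HasCuspLimit φ φ₀) (h0 : φ ≠ 0) {n : ℕ}
    (hk : k = -n) (hn : 2 ≤ n) : iteratedDeriv n φ₀ 0 ≠ 0 := by
  intro hz
  have v0 := hφ.vanishesToOrder_of_neg hlim n (by omega)
  have v1 := hφ.vanishesToOrder_succ_of_weight_zero hlim v0 (by omega) hz
  have v2 := hφ.vanishesToOrder_succ hlim v1 (Or.inr (Or.inl ⟨0, by push_cast; omega⟩))
  have v3 := hφ.vanishesToOrder_succ hlim v2 (Or.inr (Or.inr (by push_cast; omega)))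
  have v4 := hφ.vanishesToOrder_succ hlim v3 (Or.inr (Or.inl ⟨1, by push_cast; omega⟩))
  exact h0 (eq_zero_of_vanishesToOrder_six hM hφ.isHolo hmde (v4.mono (by omega)))

/-- The moments `∑ αᵢ lᵢʲ` of the `q⁰`-part, for `j` of the parity of the weight, vanish when
`k + j < 0`. -/
theorem IsWeakJacobiForm.moment_eq_zero (hφ : IsWeakJacobiForm k M φ) (hlim : HasCuspLimit φ φ₀)
    {ε α₁ α₂ α₃ : ℂ} {l₁ l₂ l₃ : ℚ}
    (hexp : HasHalfIntegralExpansion φ₀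
      (α₁ • zetaPair ε l₁ + α₂ • zetaPair ε l₂ + α₃ • zetaPair ε l₃)) (j : ℕ) (hj : k + j < 0)
    (hε : ε * (-1) ^ j = 1) :
    α₁ * (l₁ : ℂ) ^ j + α₂ * (l₂ : ℂ) ^ j + α₃ * (l₃ : ℂ) ^ j = 0 := by
  have h := (hφ.vanishesToOrder_of_neg hlim (j + 1) (by push_cast; omega)).iteratedDeriv_limit hlim
    j j.lt_succ_self
  rw [hexp.iteratedDeriv_eq, hε] at h
  exact (mul_eq_zero.mp h).resolve_left
    (mul_ne_zero (pow_ne_zero _ Complex.two_pi_I_ne_zero) (by norm_num))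

/-- The moment of weight zero does not vanish. -/
theorem IsWeakJacobiForm.moment_ne_zero (hφ : IsWeakJacobiForm k M φ) (hM : 0 < M)
    (hmde : SolvesMDE3 M k lam₁ lam₂ φ) (hlim : HasCuspLimit φ φ₀) (h0 : φ ≠ 0)
    {ε α₁ α₂ α₃ : ℂ} {l₁ l₂ l₃ : ℚ}
    (hexp : HasHalfIntegralExpansion φ₀
      (α₁ • zetaPair ε l₁ + α₂ • zetaPair ε l₂ + α₃ • zetaPair ε l₃)) {n : ℕ} (hk : k = -n)
    (hn : 2 ≤ n) : α₁ * (l₁ : ℂ) ^ n + α₂ * (l₂ : ℂ) ^ n + α₃ * (l₃ : ℂ) ^ n ≠ 0 := by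
  intro h
  refine hφ.iteratedDeriv_limit_ne_zero hM hmde hlim h0 hk hn ?_
  rw [hexp.iteratedDeriv_eq, h, mul_zero]

end Weights

end JacobiMDE

end

theorem mainTheorem6 (k : ℤ) (M : ℕ) (hM : 0 < M) (lam₁ lam₂ : ℂ)
    (φ : UpperHalfPlane → ℂ → ℂ) (hφ : JacobiMDE.IsWeakJacobiForm k M φ)
    (hmde : JacobiMDE.SolvesMDE3 M k lam₁ lam₂ φ)
    (a : ℕ → ℚ → ℂ) (ha : JacobiMDE.HasFourierExpansion M φ a) :
    -- bound on the weight
    (φ ≠ 0 → -5 ≤ k) ∧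
    -- at most three absolute values of exponents in the `q^0`-part
    ((fun l : ℚ => |l|) '' {l : ℚ | a 0 l ≠ 0}).encard ≤ 3 ∧
    -- the case of exactly three
    (∀ l₁ l₂ l₃ : ℚ, a 0 l₁ ≠ 0 → a 0 l₂ ≠ 0 → a 0 l₃ ≠ 0 →
      |l₁| ≠ |l₂| → |l₁| ≠ |l₃| → |l₂| ≠ |l₃| →
      -- relation between the exponents, and its consequence for integral index
      l₁ ^ 2 + l₂ ^ 2 + l₃ ^ 2 = -((2 * (k : ℚ) + 3) / 2) * ((M : ℚ) / 2) ∧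
      (∀ m : ℕ, M = 2 * m →
        (∃ n : ℤ, l₁ = n) ∧ (∃ n : ℤ, l₂ = n) ∧ (∃ n : ℤ, l₃ = n) ∧ Even m) ∧
      -- possible weights
      (k = -2 ∨ k = -3 ∨ k = -4 ∨ k = -5) ∧
      -- shape of the `q^0`-part, with coefficient function `a 0`
      (k = -2 → ∃ c b : ℂ, c ≠ 0 ∧
        b ≠ ((l₃ : ℂ) ^ 2 - (l₁ : ℂ) ^ 2) / ((l₂ : ℂ) ^ 2 - (l₃ : ℂ) ^ 2) ∧
        a 0 = c • ((JacobiMDE.zetaPow l₁ + JacobiMDE.zetaPow (-l₁)) +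
          b • (JacobiMDE.zetaPow l₂ + JacobiMDE.zetaPow (-l₂)) -
          (b + 1) • (JacobiMDE.zetaPow l₃ + JacobiMDE.zetaPow (-l₃)))) ∧
      (k = -4 → ∃ c : ℂ, c ≠ 0 ∧
        a 0 = c • ((JacobiMDE.zetaPow l₁ + JacobiMDE.zetaPow (-l₁)) +
          (((l₃ : ℂ) ^ 2 - (l₁ : ℂ) ^ 2) / ((l₂ : ℂ) ^ 2 - (l₃ : ℂ) ^ 2)) •
            (JacobiMDE.zetaPow l₂ + JacobiMDE.zetaPow (-l₂)) +
          (((l₁ : ℂ) ^ 2 - (l₂ : ℂ) ^ 2) / ((l₂ : ℂ) ^ 2 - (l₃ : ℂ) ^ 2)) •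
            (JacobiMDE.zetaPow l₃ + JacobiMDE.zetaPow (-l₃)))) ∧
      (k = -3 → ∃ c b : ℂ, c ≠ 0 ∧
        b ≠ ((l₁ : ℂ) * ((l₃ : ℂ) ^ 2 - (l₁ : ℂ) ^ 2)) /
          ((l₂ : ℂ) * ((l₂ : ℂ) ^ 2 - (l₃ : ℂ) ^ 2)) ∧
        a 0 = c • ((JacobiMDE.zetaPow l₁ - JacobiMDE.zetaPow (-l₁)) +
          b • (JacobiMDE.zetaPow l₂ - JacobiMDE.zetaPow (-l₂)) -
          (((l₁ : ℂ) + b * (l₂ : ℂ)) / (l₃ : ℂ)) •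
            (JacobiMDE.zetaPow l₃ - JacobiMDE.zetaPow (-l₃)))) ∧
      (k = -5 → ∃ c : ℂ, c ≠ 0 ∧
        a 0 = c • ((JacobiMDE.zetaPow l₁ - JacobiMDE.zetaPow (-l₁)) +
          (((l₁ : ℂ) * ((l₃ : ℂ) ^ 2 - (l₁ : ℂ) ^ 2)) /
            ((l₂ : ℂ) * ((l₂ : ℂ) ^ 2 - (l₃ : ℂ) ^ 2))) •
            (JacobiMDE.zetaPow l₂ - JacobiMDE.zetaPow (-l₂)) +
          (((l₁ : ℂ) * ((l₁ : ℂ) ^ 2 - (l₂ : ℂ) ^ 2)) /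
            ((l₃ : ℂ) * ((l₂ : ℂ) ^ 2 - (l₃ : ℂ) ^ 2))) •
            (JacobiMDE.zetaPow l₃ - JacobiMDE.zetaPow (-l₃))))) := by
  obtain ⟨φ₀, hlim, hexp⟩ := hφ.exists_hasCuspLimit ha
  refine ⟨hφ.neg_five_le_weight hM hmde hlim, hφ.encard_abs_exponents_le hM hmde ha, ?_⟩
  intro l₁ l₂ l₃ h₁ h₂ h₃ h₁₂ h₁₃ h₂₃
  have hsq := hφ.sum_sq_exponents hM hmde ha h₁ h₂ h₃ h₁₂ h₁₃ h₂₃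
  have hφ0 : φ ≠ 0 := by
    rintro rfl
    have hz : φ₀ = fun _ => 0 := funext fun z =>
      tendsto_nhds_unique (hlim.tendsto z) tendsto_const_nhds
    rw [hz] at hexp
    have h0 : JacobiMDE.HasHalfIntegralExpansion (fun _ => 0) (fun _ => 0) :=
      ⟨fun l hl => absurd rfl hl, fun z => by simp⟩
    exact h₁ (congrFun (hexp.unique h0) l₁)
  have hkge := hφ.neg_five_le_weight hM hmde hlim hφ0
  -- `∑ lᵢ²` is positive because at most one `lᵢ` vanishes
  have hkle : k ≤ -2 := by
    by_contra! hk
    have hk' : (-1 : ℚ) ≤ k := by exact_mod_cast hk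
    have hM' : (0 : ℚ) < M := by exact_mod_cast hM
    have hle : l₁ ^ 2 + l₂ ^ 2 + l₃ ^ 2 ≤ 0 := by
      rw [hsq]
      nlinarith
    have e₁ : l₁ = 0 := pow_eq_zero_iff two_ne_zero |>.mp (by nlinarith)
    have e₂ : l₂ = 0 := pow_eq_zero_iff two_ne_zero |>.mp (by nlinarith)
    exact h₁₂ (by rw [e₁, e₂])
  obtain ⟨α₁, α₂, α₃, hα, hshape⟩ := hφ.exists_coeff_zero_eq hM hmde ha h₁ h₂ h₃ h₁₂ h₁₃ h₂₃
  rw [hshape] at hexp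
  have hd : (l₂ : ℂ) ^ 2 - (l₃ : ℂ) ^ 2 ≠ 0 := by
    refine sub_ne_zero.mpr fun h => h₂₃ ((sq_eq_sq_iff_abs_eq_abs l₂ l₃).mp ?_)
    exact_mod_cast h
  -- in odd weight the exponent `0` does not occur
  have hodd : Odd k → ∀ l, a 0 l ≠ 0 → (l : ℂ) ≠ 0 := by
    intro hk l hl h0
    have h0' : l = 0 := by exact_mod_cast h0
    have := hφ.coeff_zero_neg ha 0
    rw [hk.neg_one_zpow, neg_zero] at this
    exact hl (by rw [h0']; linear_combination this / 2)
  refine ⟨hsq, ?_, by omega, ?_, ?_, ?_, ?_⟩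
  · intro m hm
    have hint : ∀ l, a 0 l ≠ 0 → ∃ n : ℤ, l = n := fun l =>
      hφ.exists_int_of_coeff_zero_ne_zero ha ⟨m, by omega⟩
    obtain ⟨n₁, rfl⟩ := hint l₁ h₁
    obtain ⟨n₂, rfl⟩ := hint l₂ h₂
    obtain ⟨n₃, rfl⟩ := hint l₃ h₃
    refine ⟨⟨n₁, rfl⟩, ⟨n₂, rfl⟩, ⟨n₃, rfl⟩, ?_⟩
    have hz : 2 * (n₁ ^ 2 + n₂ ^ 2 + n₃ ^ 2) = -((2 * k + 3) * m) := by
      have : (2 * (n₁ ^ 2 + n₂ ^ 2 + n₃ ^ 2) : ℚ) = -((2 * k + 3) * m) := by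
        rw [hsq, hm]
        push_cast
        ring
      exact_mod_cast this
    have hev : Even ((2 * k + 3) * (m : ℤ)) := ⟨-(n₁ ^ 2 + n₂ ^ 2 + n₃ ^ 2), by linarith⟩
    rcases Int.even_mul.mp hev with h | h
    · exact absurd h (by rw [Int.not_even_iff_odd]; exact ⟨k + 1, by ring⟩)
    · exact_mod_cast h
  · rintro rfl
    have hε : (-1 : ℂ) ^ (-2 : ℤ) = 1 := by norm_num
    rw [hε] at hexp hshape
    have m0 := hφ.moment_eq_zero hlim hexp 0 (by norm_num) (by norm_num)
    have m2 := hφ.moment_ne_zero hM hmde hlim hφ0 hexp (n := 2) (by norm_num) le_rfl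
    have hα₃ : α₃ = -(α₁ + α₂) := by linear_combination m0
    refine ⟨α₁, α₂ / α₁, hα, fun hb => m2 ?_, ?_⟩
    · rw [div_eq_div_iff hα hd] at hb
      rw [hα₃]
      linear_combination hb
    · rw [hshape, hα₃]
      funext l
      simp only [JacobiMDE.zetaPair, Pi.add_apply, Pi.sub_apply, Pi.smul_apply, smul_eq_mul]
      field_simp
      ring
  · rintro rfl
    have hε : (-1 : ℂ) ^ (-4 : ℤ) = 1 := by norm_num
    rw [hε] at hexp hshape
    have m0 := hφ.moment_eq_zero hlim hexp 0 (by norm_num) (by norm_num)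
    have m2 := hφ.moment_eq_zero hlim hexp 2 (by norm_num) (by norm_num)
    have hα₂ : α₂ = α₁ * (((l₃ : ℂ) ^ 2 - l₁ ^ 2) / ((l₂ : ℂ) ^ 2 - l₃ ^ 2)) := by
      field_simp
      linear_combination m2 - (l₃ : ℂ) ^ 2 * m0
    have hα₃ : α₃ = α₁ * (((l₁ : ℂ) ^ 2 - l₂ ^ 2) / ((l₂ : ℂ) ^ 2 - l₃ ^ 2)) := by
      field_simp
      linear_combination (l₂ : ℂ) ^ 2 * m0 - m2
    refine ⟨α₁, hα, ?_⟩
    rw [hshape, hα₂, hα₃]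
    funext l
    simp only [JacobiMDE.zetaPair, Pi.add_apply, Pi.smul_apply, smul_eq_mul]
    ring
  · rintro rfl
    have hε : (-1 : ℂ) ^ (-3 : ℤ) = -1 := by norm_num
    have n₂ := hodd (by decide) l₂ h₂
    have n₃ := hodd (by decide) l₃ h₃
    rw [hε] at hexp hshape
    have m1 := hφ.moment_eq_zero hlim hexp 1 (by norm_num) (by norm_num)
    have m3 := hφ.moment_ne_zero hM hmde hlim hφ0 hexp (n := 3) (by norm_num) (by norm_num)
    have hα₃ : α₃ = -((α₁ * l₁ + α₂ * l₂) / l₃) := by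
      field_simp
      linear_combination m1
    refine ⟨α₁, α₂ / α₁, hα, fun hb => m3 ?_, ?_⟩
    · rw [div_eq_div_iff hα (mul_ne_zero n₂ hd)] at hb
      rw [hα₃]
      field_simp
      linear_combination hb
    · rw [hshape, hα₃]
      funext l
      simp only [JacobiMDE.zetaPair, Pi.add_apply, Pi.sub_apply, Pi.smul_apply, smul_eq_mul]
      field_simp
      ring
  · rintro rfl
    have hε : (-1 : ℂ) ^ (-5 : ℤ) = -1 := by norm_num
    have n₂ := hodd (by decide) l₂ h₂
    have n₃ := hodd (by decide) l₃ h₃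
    rw [hε] at hexp hshape
    have m1 := hφ.moment_eq_zero hlim hexp 1 (by norm_num) (by norm_num)
    have m3 := hφ.moment_eq_zero hlim hexp 3 (by norm_num) (by norm_num)
    have hα₂ : α₂ = α₁ * ((l₁ * ((l₃ : ℂ) ^ 2 - l₁ ^ 2)) / (l₂ * ((l₂ : ℂ) ^ 2 - l₃ ^ 2))) := by
      field_simp
      linear_combination m3 - (l₃ : ℂ) ^ 2 * m1
    have hα₃ : α₃ = α₁ * ((l₁ * ((l₁ : ℂ) ^ 2 - l₂ ^ 2)) / (l₃ * ((l₂ : ℂ) ^ 2 - l₃ ^ 2))) := by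
      field_simp
      linear_combination (l₂ : ℂ) ^ 2 * m1 - m3
    refine ⟨α₁, hα, ?_⟩
    rw [hshape, hα₂, hα₃]
    funext l
    simp only [JacobiMDE.zetaPair, Pi.add_apply, Pi.sub_apply, Pi.smul_apply, smul_eq_mul]
    ring
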